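/- For a real random variable $W$ let $\|W\|_{\psi_2}=\inf\{c>0:\ \mathbb E\exp(W^2/c^2)\le 2\}$. There exist positive constants $c_1,c_2,c_3,c_4$, depending only on $\|W\|_{\psi_2}$, for which the following holds. Let $W$ be a random variable with $\mathbb E W=0$, $\mathbb E W^2=1$, $\mathbb E W^3=0$ and $\|W\|_{\psi_2}<\infty$, whose law is absolutely continuous with respect to Lebesgue measure. Let $n\ge 1$ and $M\ge 2$ be integers, let $W_1,\dots,W_n$ be independent random variables distributed as $W$, put $\bar X=n^{-1/2}\sum_{i=1}^n W_i$, and let $\bar X_2,\dots,\bar X_M$ be $M-1$ independent copies of $\bar X$. Let $\gamma_1\in\mathbb R$ satisfy $$\mathbb P\Bigl[\min_{2\le j\le M}\bar X_j\le\gamma_1\Bigr]=1-\frac1n ,$$ and assume that $\gamma_1\le -2$. If $$c_3\log n\le M\le c_4\sqrt n\,\log n\qquad\text{and}\qquad 2M^2\exp(-c_1n^{1/3})<\delta\le 1,$$ then $$\mathbb P\Bigl[\exists j\in\{2,\dots,M\}:\ \bar X_j\le\gamma_1\ \text{and}\ \bar X_k-\bar X_j\ge\delta\ \text{for every }k\in\{2,\dots,M\}\setminus\{j\}\Bigr]\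 \ge\ 1-\frac1n-c_2\Bigl(\frac1{\sqrt n}+\delta\Bigr)(\log n)^2\sqrt{\log M}.$$ -/

import Mathlib

open MeasureTheory ProbabilityTheory

/-- The admissible constants in the definition of the `ψ_α` norm of `W`: those `c > 0` with
`𝔼 exp (|W| ^ α / c ^ α) ≤ 2`. The expectation is a lower integral, so an infinite
expectation is never admissible. -/
def psiConstants {Ω : Type*} [MeasurableSpace Ω] (α : ℝ) (W : Ω → ℝ) (μ : Measure Ω) : Set ℝ :=
  {c : ℝ | 0 < c ∧ ∫⁻ ω, ENNReal.ofReal (Real.exp (|W ω| ^ α / c ^ α)) ∂μ ≤ 2}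

/-- `W` belongs to the Orlicz space `L_{ψ_α}`. -/
def MemPsi {Ω : Type*} [MeasurableSpace Ω] (α : ℝ) (W : Ω → ℝ) (μ : Measure Ω) : Prop :=
  (psiConstants α W μ).Nonempty

/-- The `ψ_α` norm of `W`; it is meaningful for `W` in `L_{ψ_α}`. -/
noncomputable def psiNorm {Ω : Type*} [MeasurableSpace Ω] (α : ℝ) (W : Ω → ℝ)
    (μ : Measure Ω) : ℝ :=
  sInf (psiConstants α W μ)

/-- The normalized sum `n ^ (-1/2) * ∑ i, V i` of `n` random variables. -/
noncomputable def normalizedSum {Ω : Type*} {n : ℕ} (V : Fin n → Ω → ℝ) (ω : Ω) : ℝ :=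
  (∑ i, V i ω) / Real.sqrt n

/-! Write `ρ` for the common law of the `X j`, `N = M - 1`, `l = -γ₁` and `p = ρ (-∞, γ₁]`. If the
minimum is at most `γ₁` but the minimiser `j` is not isolated, some other `X k` lies in `[X j, X j +
δ)`. A union bound over ordered pairs makes this event cost at most `N² p Q`, where `Q` bounds `ρ
[x, x + δ)` for all `x ≤ γ₁`. Since `(1 - p) ^ N = 1 / n`, one has `N p ≤ log n`, so it is enough
that `Q` be a small multiple of `p`, namely `Q ≤ C (1 / √n + δ) l p`. Moreover `p ≥ 1 / (2 M)`, so
Chernoff's bound gives `l = O(√(log M))`.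

The comparison of `Q` with `p` (`exists_measureReal_iterConv_Ico_le`) takes place at a moderate
deviation. The law of `W` is tilted by `exp (-s x)` with `s = l / √n`, which moves the mean of the
sum to about `-√n l`. Under the tilted law, Esseen's inequality bounds the mass of an interval of
length `√n δ` by `O(1 / √n + δ)`, while a Lindeberg comparison with a Gaussian shows that the window
`√n [-l - 1 / l, -l]`, which lies in the tail, has mass at least a constant over `l`. Undoing the
tilt multiplies both estimates by the same `Z ^ n`, where `Z = ∫ exp (-s x)` is the tilt's
normalizing constant, and by weights that agree up to a constant factor, so their quotient is the
claim. The Lindeberg error `l³ / √n` must be small against `1 / l`, hence the condition `l⁴ ≤ η √n`;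
it holds for large `n` because `l² = O(log n)`. -/

/-! ### Convolution powers and exponential tilting. -/

/-- The `n`-fold convolution power of a measure on `ℝ`. -/
noncomputable def iterConv (ν : Measure ℝ) : ℕ → Measure ℝ
  | 0 => Measure.dirac 0
  | n + 1 => (iterConv ν n).conv ν

instance iterConv.isProbabilityMeasure (ν : Measure ℝ) [IsProbabilityMeasure ν] (n : ℕ) :
    IsProbabilityMeasure (iterConv ν n) := by
  induction n with
  | zero => unfold iterConv; infer_instance
  | succ n ih => unfold iterConv; infer_instance

lemma charFun_iterConv (ν : Measure ℝ) [IsProbabilityMeasure ν] (n : ℕ) (t : ℝ) :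
    charFun (iterConv ν n) t = charFun ν t ^ n := by
  induction n with
  | zero => simp [iterConv, charFun_dirac]
  | succ n ih => rw [iterConv, charFun_conv, ih, pow_succ]

lemma map_sum_eq_iterConv {Ω : Type*} [MeasurableSpace Ω] {μ : Measure Ω}
    [IsProbabilityMeasure μ] {n : ℕ} {V : Fin n → Ω → ℝ} {ν : Measure ℝ} [IsProbabilityMeasure ν]
    (hV : iIndepFun V μ) (hm : ∀ i, AEMeasurable (V i) μ) (hν : ∀ i, μ.map (V i) = ν) :
    μ.map (fun ω => ∑ i, V i ω) = iterConv ν n := by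
  have hs : AEMeasurable (fun ω => ∑ i, V i ω) μ :=
    Finset.aemeasurable_fun_sum _ fun i _ => hm i
  have : IsProbabilityMeasure (μ.map fun ω => ∑ i, V i ω) :=
    Measure.isProbabilityMeasure_map hs
  refine Measure.ext_of_charFun (funext fun t => ?_)
  have h := congrFun (hV.charFun_map_fun_sum_eq_prod hm) t
  rw [h, charFun_iterConv]
  simp [hν]

lemma iterConv_gaussianReal (m : ℝ) (v : NNReal) (n : ℕ) :
    iterConv (gaussianReal m v) n = gaussianReal (n * m) (n * v) := by
  induction n with
  | zero => simp [iterConv]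
  | succ n ih =>
    rw [iterConv, ih, gaussianReal_conv_gaussianReal]
    push_cast
    congr 1 <;> ring

/-- Exponential tilting commutes with convolution powers. -/
lemma iterConv_tilted (ν : Measure ℝ) [IsProbabilityMeasure ν] (s : ℝ)
    (hi : Integrable (fun x => Real.exp (-s * x)) ν) (n : ℕ) :
    iterConv (ν.tilted fun x => -s * x) n = (iterConv ν n).withDensity
      fun x => ENNReal.ofReal (Real.exp (-s * x) / (∫ y, Real.exp (-s * y) ∂ν) ^ n) := by
  have hp : IsProbabilityMeasure (ν.tilted fun x => -s * x) := isProbabilityMeasure_tilted hi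
  have hZ : 0 < ∫ y, Real.exp (-s * y) ∂ν := integral_exp_pos hi
  set Z := ∫ y, Real.exp (-s * y) ∂ν with hZdef
  induction n with
  | zero =>
    simp only [iterConv, pow_zero, div_one]
    refine Measure.ext fun A hA => ?_
    rw [withDensity_apply _ hA, ← lintegral_indicator hA, lintegral_dirac, ← lintegral_indicator_one hA,
      lintegral_dirac]
    by_cases h : (0 : ℝ) ∈ A <;> simp [h]
  | succ n ih =>
    refine Measure.ext_of_lintegral _ fun f hf => ?_
    have hm : ∀ k : ℕ, Measurable fun x => ENNReal.ofReal (Real.exp (-s * x) / Z ^ k) :=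
      fun k => by fun_prop
    have hg : Measurable fun x => ∫⁻ y, f (x + y) ∂(ν.tilted fun x => -s * x) :=
      (hf.comp (measurable_fst.add measurable_snd)).lintegral_prod_right'
    rw [lintegral_withDensity_eq_lintegral_mul _ (hm _) hf, iterConv, iterConv,
      Measure.lintegral_conv hf, Measure.lintegral_conv ((hm _).mul hf), ih,
      lintegral_withDensity_eq_lintegral_mul _ (hm _) hg]
    refine lintegral_congr fun x => ?_
    simp only [Pi.mul_apply]
    rw [Measure.tilted, lintegral_withDensity_eq_lintegral_mul _ (by fun_prop) (by fun_prop),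
      ← lintegral_const_mul _ (by fun_prop)]
    refine lintegral_congr fun y => ?_
    simp only [Pi.mul_apply]
    rw [← mul_assoc, ← ENNReal.ofReal_mul (by positivity)]
    congr 2
    rw [← hZdef, mul_add, Real.exp_add]
    field_simp
    ring

/-- The factor `Z ^ n` stays explicit here and in the reverse estimate below, so that it cancels
when the two are combined. -/
lemma mul_measureReal_iterConv_le (ν : Measure ℝ) [IsProbabilityMeasure ν] {s D : ℝ}
    (hi : Integrable (fun x => Real.exp (-s * x)) ν) (n : ℕ) {A : Set ℝ} (hA : MeasurableSet A)
    (hD0 : 0 ≤ D) (hD : ∀ x ∈ A, D ≤ Real.exp (-s * x)) :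
    D * (iterConv ν n).real A ≤
      (∫ y, Real.exp (-s * y) ∂ν) ^ n * (iterConv (ν.tilted fun x => -s * x) n).real A := by
  have hp : IsProbabilityMeasure (ν.tilted fun x => -s * x) := isProbabilityMeasure_tilted hi
  have hZ : 0 < ∫ y, Real.exp (-s * y) ∂ν := integral_exp_pos hi
  set Z := ∫ y, Real.exp (-s * y) ∂ν with hZdef
  have h : ENNReal.ofReal (D / Z ^ n) * iterConv ν n A ≤
      iterConv (ν.tilted fun x => -s * x) n A := by
    rw [iterConv_tilted ν s hi, withDensity_apply _ hA, ← setLIntegral_const]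
    refine setLIntegral_mono (by fun_prop) fun x hx => ENNReal.ofReal_le_ofReal ?_
    gcongr
    exact hD x hx
  have h2 := ENNReal.toReal_mono (measure_ne_top _ _) h
  rw [ENNReal.toReal_mul, ENNReal.toReal_ofReal (by positivity)] at h2
  change _ ≤ Z ^ n * (iterConv (ν.tilted fun x => -s * x) n A).toReal
  calc D * (iterConv ν n A).toReal = Z ^ n * (D / Z ^ n * (iterConv ν n A).toReal) := by field_simp
    _ ≤ _ := by gcongr

lemma mul_measureReal_iterConv_tilted_le (ν : Measure ℝ) [IsProbabilityMeasure ν] {s D : ℝ}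
    (hi : Integrable (fun x => Real.exp (-s * x)) ν) (n : ℕ) {A : Set ℝ} (hA : MeasurableSet A)
    (hD0 : 0 ≤ D) (hD : ∀ x ∈ A, Real.exp (-s * x) ≤ D) :
    (∫ y, Real.exp (-s * y) ∂ν) ^ n * (iterConv (ν.tilted fun x => -s * x) n).real A ≤
      D * (iterConv ν n).real A := by
  have hp : IsProbabilityMeasure (ν.tilted fun x => -s * x) := isProbabilityMeasure_tilted hi
  have hZ : 0 < ∫ y, Real.exp (-s * y) ∂ν := integral_exp_pos hi
  set Z := ∫ y, Real.exp (-s * y) ∂ν with hZdef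
  have h : iterConv (ν.tilted fun x => -s * x) n A ≤
      ENNReal.ofReal (D / Z ^ n) * iterConv ν n A := by
    rw [iterConv_tilted ν s hi, withDensity_apply _ hA, ← setLIntegral_const]
    refine setLIntegral_mono (by fun_prop) fun x hx => ENNReal.ofReal_le_ofReal ?_
    gcongr
    exact hD x hx
  have h2 := ENNReal.toReal_mono (ENNReal.mul_ne_top ENNReal.ofReal_ne_top (measure_ne_top _ _)) h
  rw [ENNReal.toReal_mul, ENNReal.toReal_ofReal (by positivity)] at h2
  change Z ^ n * (iterConv (ν.tilted fun x => -s * x) n A).toReal ≤ D * (iterConv ν n A).toReal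
  calc Z ^ n * (iterConv (ν.tilted fun x => -s * x) n A).toReal
      ≤ Z ^ n * (D / Z ^ n * (iterConv ν n A).toReal) := by gcongr
    _ = _ := by field_simp

/-! ### Esseen's concentration inequality. -/

/-- The triangular weight has a nonnegative Fourier transform, bounded below near the origin. It
therefore majorizes a multiple of the indicator of a window, and its mean under a law is an average
of the characteristic function. -/
lemma integral_one_sub_mul_cos (y : ℝ) (hy : y ≠ 0) :
    ∫ u in (0 : ℝ)..1, (1 - u) * Real.cos (u * y) = (1 - Real.cos y) / y ^ 2 := by
  have h : ∀ u ∈ Set.uIcc (0 : ℝ) 1, HasDerivAt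
      (fun u => (1 - u) * (Real.sin (u * y) / y) - Real.cos (u * y) / y ^ 2)
      ((1 - u) * Real.cos (u * y)) u := by
    intro u _
    have h1 : HasDerivAt (fun u : ℝ => u * y) y u := by simpa using (hasDerivAt_id u).mul_const y
    have h2 : HasDerivAt (fun u : ℝ => 1 - u) (-1) u := by
      simpa using (hasDerivAt_id u).const_sub 1
    convert! (h2.mul (h1.sin.div_const y)).sub (h1.cos.div_const (y ^ 2)) using 1
    field_simp
    ring
  rw [intervalIntegral.integral_eq_sub_of_hasDerivAt h
    (Continuous.intervalIntegrable (by fun_prop) _ _)]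
  simp
  ring

lemma integral_one_sub_mul_cos_nonneg (y : ℝ) :
    0 ≤ ∫ u in (0 : ℝ)..1, (1 - u) * Real.cos (u * y) := by
  by_cases hy : y = 0
  · subst hy
    refine intervalIntegral.integral_nonneg zero_le_one fun u hu => ?_
    simpa using hu.2
  · rw [integral_one_sub_mul_cos y hy]
    have := Real.cos_le_one y
    exact div_nonneg (by linarith) (by positivity)

lemma quarter_le_integral_one_sub_mul_cos {y : ℝ} (hy : |y| ≤ 1) :
    1 / 4 ≤ ∫ u in (0 : ℝ)..1, (1 - u) * Real.cos (u * y) := by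
  have h : ∫ u in (0 : ℝ)..1, (1 - u) * (1 / 2) = 1 / 4 := by
    rw [intervalIntegral.integral_mul_const, intervalIntegral.integral_sub] <;> norm_num
  rw [← h]
  refine intervalIntegral.integral_mono_on zero_le_one
    (Continuous.intervalIntegrable (by fun_prop) _ _)
    (Continuous.intervalIntegrable (by fun_prop) _ _) fun u hu => ?_
  refine mul_le_mul_of_nonneg_left ?_ (by linarith [hu.2])
  have h1 := Real.one_sub_sq_div_two_le_cos (x := u * y)
  have h2 : (u * y) ^ 2 ≤ 1 := by
    rw [sq_le_one_iff_abs_le_one, abs_mul, abs_of_nonneg hu.1]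
    exact mul_le_one₀ hu.2 (abs_nonneg _) hy
  linarith

lemma integral_cos_le_norm_charFun (μ : Measure ℝ) [IsProbabilityMeasure μ] (t a : ℝ) :
    ∫ y, Real.cos (t * (y - a)) ∂μ ≤ ‖charFun μ t‖ := by
  have h : ∫ y, Real.cos (t * (y - a)) ∂μ
      = (Complex.exp (-(t * a : ℝ) * Complex.I) * charFun μ t).re := by
    rw [charFun_apply_real, ← integral_const_mul]
    have hi : Integrable (fun y : ℝ => Complex.exp (-(t * a : ℝ) * Complex.I) *
        Complex.exp (t * y * Complex.I)) μ := by
      refine (integrable_const (1 : ℝ)).mono (by fun_prop) (ae_of_all _ fun y => ?_)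
      rw [norm_mul, ← Complex.ofReal_neg, Complex.norm_exp_ofReal_mul_I, ← Complex.ofReal_mul,
        Complex.norm_exp_ofReal_mul_I]
      simp
    have := integral_re hi
    simp only [RCLike.re_to_complex] at this
    rw [← this]
    refine integral_congr_ae (ae_of_all _ fun y => ?_)
    simp only
    rw [← Complex.exp_add, ← Complex.exp_ofReal_mul_I_re]
    congr 2
    push_cast
    ring
  rw [h]
  refine (Complex.re_le_norm _).trans ?_
  rw [norm_mul, ← Complex.ofReal_neg, Complex.norm_exp_ofReal_mul_I, one_mul]

/-- Esseen's concentration inequality. -/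
lemma measureReal_abs_sub_le_integral_charFun (μ : Measure ℝ) [IsProbabilityMeasure μ]
    {r : ℝ} (a : ℝ) :
    μ.real {y | |r * (y - a)| ≤ 1} ≤ 4 * ∫ u in (0 : ℝ)..1, ‖charFun μ (u * r)‖ := by
  have hbd : Integrable (Function.uncurry fun (y u : ℝ) => (1 - u) * Real.cos (u * (r * (y - a))))
      (μ.prod (volume.restrict (Set.Ioc (0 : ℝ) 1))) := by
    have h1 : Integrable (fun _ : ℝ × ℝ => (1 : ℝ))
      (μ.prod (volume.restrict (Set.Ioc (0 : ℝ) 1))) := integrable_const _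
    refine h1.mono (by fun_prop) ?_
    have h2 : ∀ᵐ p ∂(μ.prod (volume.restrict (Set.Ioc (0 : ℝ) 1))), p.2 ∈ Set.Ioc (0 : ℝ) 1 := by
      refine Measure.quasiMeasurePreserving_snd.ae
        (ae_restrict_mem (s := Set.Ioc (0 : ℝ) 1) measurableSet_Ioc)
    filter_upwards [h2] with p hp
    simp only [Function.uncurry, norm_mul, Real.norm_eq_abs, norm_one]
    have h3 := Real.abs_cos_le_one (p.2 * (r * (p.1 - a)))
    have h4 : |1 - p.2| ≤ 1 := by rw [abs_le]; constructor <;> linarith [hp.1, hp.2]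
    simpa using mul_le_one₀ h4 (abs_nonneg _) h3
  have hswap := integral_integral_swap hbd
  have hI : Integrable (fun y => ∫ u in (0 : ℝ)..1, (1 - u) * Real.cos (u * (r * (y - a)))) μ := by
    simpa only [intervalIntegral.integral_of_le zero_le_one, Function.uncurry]
      using hbd.integral_prod_left
  have hlow : μ.real {y | |r * (y - a)| ≤ 1} * (1 / 4) ≤
      ∫ y, (∫ u in (0 : ℝ)..1, (1 - u) * Real.cos (u * (r * (y - a)))) ∂μ := by
    have hS : MeasurableSet {y : ℝ | |r * (y - a)| ≤ 1} :=
      measurableSet_le (by fun_prop) measurable_const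
    rw [← smul_eq_mul, ← integral_indicator_const _ hS]
    refine integral_mono ((integrable_const _).indicator hS) hI fun y => ?_
    by_cases hy : y ∈ {y : ℝ | |r * (y - a)| ≤ 1}
    · rw [Set.indicator_of_mem hy]
      exact quarter_le_integral_one_sub_mul_cos hy
    · rw [Set.indicator_of_notMem hy]
      exact integral_one_sub_mul_cos_nonneg _
  have hup : ∫ y, (∫ u in (0 : ℝ)..1, (1 - u) * Real.cos (u * (r * (y - a)))) ∂μ ≤
      ∫ u in (0 : ℝ)..1, ‖charFun μ (u * r)‖ := by
    simp only [intervalIntegral.integral_of_le zero_le_one]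
    rw [hswap]
    refine setIntegral_mono_on hbd.integral_prod_right ?_ measurableSet_Ioc fun u hu => ?_
    · refine Measure.integrableOn_of_bounded (M := 1) (by simp) ?_ ?_
      · exact (measurable_charFun.comp (measurable_id.mul_const r)).norm.aestronglyMeasurable
      · exact ae_of_all _ fun u => by simpa using norm_charFun_le_one (μ := μ) (u * r)
    · rw [integral_const_mul]
      have h := integral_cos_le_norm_charFun μ (u * r) a
      simp only [mul_assoc] at h ⊢
      have h0 : 0 ≤ ‖charFun μ (u * r)‖ := norm_nonneg _
      calc (1 - u) * ∫ y, Real.cos (u * (r * (y - a))) ∂μ ≤ (1 - u) * ‖charFun μ (u * r)‖ :=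
            mul_le_mul_of_nonneg_left h (by linarith [hu.2])
        _ ≤ ‖charFun μ (u * r)‖ := by nlinarith [hu.1]
  linarith

/-! ### Concentration of sums from three moments. -/

/-- `τ` has mean `m`, variance `v ∈ [1/2, 2]` and third absolute central moment at most `B`. -/
structure CentralMoments (τ : Measure ℝ) (m v B : ℝ) : Prop where
  integrable_cube : Integrable (fun y => |y - m| ^ 3) τ
  mean : ∫ y, (y - m) ∂τ = 0
  var : ∫ y, (y - m) ^ 2 ∂τ = v
  half_le : 1 / 2 ≤ v
  le_two : v ≤ 2
  third : ∫ y, |y - m| ^ 3 ∂τ ≤ B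

namespace CentralMoments

variable {τ : Measure ℝ} [IsProbabilityMeasure τ] {m v B : ℝ}

lemma integrable_sq (h : CentralMoments τ m v B) : Integrable (fun y => (y - m) ^ 2) τ := by
  refine ((integrable_const (1 : ℝ)).add h.integrable_cube).mono' (by fun_prop)
    (ae_of_all _ fun y => ?_)
  simp only [Real.norm_eq_abs, Pi.add_apply]
  rw [abs_of_nonneg (sq_nonneg _), ← sq_abs]
  have := abs_nonneg (y - m)
  nlinarith [sq_nonneg (|y - m| - 1)]

lemma integrable_sub (h : CentralMoments τ m v B) : Integrable (fun y => y - m) τ := by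
  refine ((integrable_const (1 : ℝ)).add h.integrable_sq).mono' (by fun_prop)
    (ae_of_all _ fun y => ?_)
  simp only [Real.norm_eq_abs, Pi.add_apply]
  rw [← sq_abs]
  nlinarith [sq_nonneg (|y - m| - 1)]

end CentralMoments

/-- For `|x| ≤ 1` this is the quadratic bound with `2 / π² ≥ 1 / 5`; for larger `|x|` the cube
outweighs the square. -/
lemma cos_le_one_sub_sq_add_cube (x : ℝ) :
    Real.cos x ≤ 1 - x ^ 2 / 5 + |x| ^ 3 / 5 := by
  have hsq : |x| ^ 2 = x ^ 2 := sq_abs x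
  have h0 := abs_nonneg x
  by_cases hx : |x| ≤ 1
  · have h := Real.cos_le_one_sub_mul_cos_sq (x := x) (by linarith [Real.pi_gt_three])
    have hpi : (1 : ℝ) / 5 ≤ 2 / Real.pi ^ 2 := by
      rw [div_le_div_iff₀ (by norm_num) (by positivity)]
      nlinarith [Real.pi_lt_d2, Real.pi_gt_three]
    have : 1 / 5 * x ^ 2 ≤ 2 / Real.pi ^ 2 * x ^ 2 := by gcongr
    have : 0 ≤ |x| ^ 3 := by positivity
    linarith
  · have h := Real.cos_le_one x
    have : x ^ 2 ≤ |x| ^ 3 := by rw [← hsq]; nlinarith [sq_nonneg |x|]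
    linarith

/-- Centring changes only the phase. After it the sine integral is of third order, so adding the two
absolute values loses nothing that matters. -/
lemma norm_charFun_eq_of_centered (τ : Measure ℝ) [IsProbabilityMeasure τ] (m t : ℝ) :
    ‖charFun τ t‖ ≤ |∫ y, Real.cos (t * (y - m)) ∂τ| + |∫ y, Real.sin (t * (y - m)) ∂τ| := by
  have hi : Integrable (fun y : ℝ => Complex.exp ((t * (y - m) : ℝ) * Complex.I)) τ := by
    refine (integrable_const (1 : ℝ)).mono (by fun_prop) (ae_of_all _ fun y => ?_)
    rw [Complex.norm_exp_ofReal_mul_I]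
    simp
  have h : ‖charFun τ t‖ = ‖∫ y : ℝ, Complex.exp ((t * (y - m) : ℝ) * Complex.I) ∂τ‖ := by
    have : ∫ y : ℝ, Complex.exp ((t * (y - m) : ℝ) * Complex.I) ∂τ =
        Complex.exp ((-(t * m) : ℝ) * Complex.I) * charFun τ t := by
      rw [charFun_apply_real, ← integral_const_mul]
      refine integral_congr_ae (ae_of_all _ fun y => ?_)
      simp only
      rw [← Complex.exp_add]
      congr 1
      push_cast
      ring
    rw [this, norm_mul, Complex.norm_exp_ofReal_mul_I, one_mul]
  rw [h]
  refine (Complex.norm_le_abs_re_add_abs_im _).trans (le_of_eq ?_)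
  have h1 := integral_re hi
  have h2 := integral_im hi
  simp only [RCLike.re_to_complex, RCLike.im_to_complex,
    Complex.exp_ofReal_mul_I_re, Complex.exp_ofReal_mul_I_im] at h1 h2
  rw [← h1, ← h2]

/-- The condition `8 * B * t ≤ 1` keeps the cubic errors of the cosine and sine integrals below a
fixed fraction of the quadratic decrease. -/
lemma CentralMoments.norm_charFun_le {τ : Measure ℝ} [IsProbabilityMeasure τ] {m v B t : ℝ}
    (h : CentralMoments τ m v B) (hB : 1 ≤ B) (ht0 : 0 ≤ t) (ht : 8 * B * t ≤ 1) :
    ‖charFun τ t‖ ≤ Real.exp (-(t ^ 2 / 20)) := by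
  have hcos : Integrable (fun y => Real.cos (t * (y - m))) τ :=
    (integrable_const (1 : ℝ)).mono (by fun_prop)
      (ae_of_all _ fun y => by simpa using Real.abs_cos_le_one _)
  have hsin : Integrable (fun y => Real.sin (t * (y - m))) τ :=
    (integrable_const (1 : ℝ)).mono (by fun_prop)
      (ae_of_all _ fun y => by simpa using Real.abs_sin_le_one _)
  have hlin : Integrable (fun y => 1 - t ^ 2 / 5 * (y - m) ^ 2) τ :=
    (integrable_const _).sub (h.integrable_sq.const_mul _)
  have ht1 : t ≤ 1 / 8 := by nlinarith
  have hv1 := h.half_le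
  have hv2 := h.le_two
  have hc1 : ∫ y, Real.cos (t * (y - m)) ∂τ ≤ 1 - t ^ 2 / 5 * v + t ^ 3 / 5 * B := by
    calc ∫ y, Real.cos (t * (y - m)) ∂τ
        ≤ ∫ y, (1 - t ^ 2 / 5 * (y - m) ^ 2 + t ^ 3 / 5 * |y - m| ^ 3) ∂τ := by
          refine integral_mono hcos (hlin.add (h.integrable_cube.const_mul _)) fun y => ?_
          have := cos_le_one_sub_sq_add_cube (t * (y - m))
          rw [abs_mul, abs_of_nonneg ht0] at this
          simp only
          linarith [mul_pow t (y - m) 2, mul_pow t |y - m| 3]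
      _ = 1 - t ^ 2 / 5 * v + t ^ 3 / 5 * ∫ y, |y - m| ^ 3 ∂τ := by
          rw [integral_add hlin
            (h.integrable_cube.const_mul _), integral_sub (integrable_const _)
            (h.integrable_sq.const_mul _), integral_const_mul, integral_const_mul, h.var]
          simp
      _ ≤ _ := by gcongr; exact h.third
  have hc2 : 1 - t ^ 2 / 2 * v ≤ ∫ y, Real.cos (t * (y - m)) ∂τ := by
    calc 1 - t ^ 2 / 2 * v = ∫ y, (1 - t ^ 2 / 2 * (y - m) ^ 2) ∂τ := by
          rw [integral_sub (integrable_const _) (h.integrable_sq.const_mul _), integral_const_mul,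
            h.var]
          simp
      _ ≤ _ := by
          refine integral_mono ((integrable_const _).sub (h.integrable_sq.const_mul _)) hcos
            fun y => ?_
          have := Real.one_sub_sq_div_two_le_cos (x := t * (y - m))
          simp only
          linarith [mul_pow t (y - m) 2]
  have hs : |∫ y, Real.sin (t * (y - m)) ∂τ| ≤ t ^ 3 / 6 * B := by
    have h0 : ∫ y, Real.sin (t * (y - m)) ∂τ
        = -∫ y, (t * (y - m) - Real.sin (t * (y - m))) ∂τ := by
      rw [integral_sub (h.integrable_sub.const_mul _) hsin, integral_const_mul, h.mean]
      simp
    rw [h0, abs_neg]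
    calc |∫ y, (t * (y - m) - Real.sin (t * (y - m))) ∂τ|
        ≤ ∫ y, |t * (y - m) - Real.sin (t * (y - m))| ∂τ := abs_integral_le_integral_abs
      _ ≤ ∫ y, t ^ 3 / 6 * |y - m| ^ 3 ∂τ := by
          refine integral_mono ((h.integrable_sub.const_mul _).sub hsin).abs
            (h.integrable_cube.const_mul _) fun y => ?_
          have := Real.abs_sub_sin_le (t * (y - m))
          rw [abs_mul, abs_of_nonneg ht0] at this
          simp only
          linarith [mul_pow t |y - m| 3]
      _ = t ^ 3 / 6 * ∫ y, |y - m| ^ 3 ∂τ := integral_const_mul _ _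
      _ ≤ _ := by gcongr; exact h.third
  have hpos : 0 ≤ ∫ y, Real.cos (t * (y - m)) ∂τ := by nlinarith
  have h1 := norm_charFun_eq_of_centered τ m t
  rw [abs_of_nonneg hpos] at h1
  have h2 : t ^ 3 * B ≤ t ^ 2 / 8 := by nlinarith [sq_nonneg t]
  have h3 : t ^ 2 * (1 / 2) ≤ t ^ 2 * v := by gcongr
  have h4 := Real.add_one_le_exp (-(t ^ 2 / 20))
  nlinarith [sq_nonneg t]

lemma CentralMoments.measureReal_iterConv_Icc_le {τ : Measure ℝ} [IsProbabilityMeasure τ]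
    {m v B : ℝ} (h : CentralMoments τ m v B) (hB : 1 ≤ B) {n : ℕ} (hn : 1 ≤ n) (a : ℝ) :
    (iterConv τ n).real (Set.Icc a (a + 1)) ≤ 128 * B / Real.sqrt n := by
  -- The largest frequency at which the Gaussian decay of the characteristic function is available.
  set r : ℝ := 1 / (8 * B) with hr
  have hr0 : 0 < r := by positivity
  have hrB : 8 * B * r = 1 := by rw [hr]; field_simp
  have hn0 : (0 : ℝ) < n := by exact_mod_cast hn
  have h1 : (iterConv τ n).real (Set.Icc a (a + 1)) ≤
      (iterConv τ n).real {y | |r * (y - a)| ≤ 1} := by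
    refine measureReal_mono fun y hy => ?_
    have h0 : 0 ≤ y - a := by linarith [hy.1]
    have h2 : y - a ≤ 1 := by linarith [hy.2]
    simp only [Set.mem_ofPred_eq]
    rw [abs_of_nonneg (by positivity)]
    nlinarith
  refine h1.trans ((measureReal_abs_sub_le_integral_charFun _ a).trans ?_)
  set b : ℝ := n * r ^ 2 / 20 with hb
  have hb0 : 0 < b := by positivity
  have h2 : ∫ u in (0 : ℝ)..1, ‖charFun (iterConv τ n) (u * r)‖ ≤
      ∫ u in Set.Ioi (0 : ℝ), Real.exp (-b * u ^ 2) := by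
    rw [intervalIntegral.integral_of_le zero_le_one]
    have hint : IntegrableOn (fun u : ℝ => Real.exp (-b * u ^ 2)) (Set.Ioi 0) :=
      (integrable_exp_neg_mul_sq hb0).integrableOn
    calc ∫ u in Set.Ioc (0 : ℝ) 1, ‖charFun (iterConv τ n) (u * r)‖
        ≤ ∫ u in Set.Ioc (0 : ℝ) 1, Real.exp (-b * u ^ 2) := by
          refine setIntegral_mono_on ?_ (hint.mono_set fun u hu => hu.1) measurableSet_Ioc
            fun u hu => ?_
          · refine Measure.integrableOn_of_bounded (M := 1) (by simp) ?_ ?_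
            · exact (measurable_charFun.comp (measurable_id.mul_const r)).norm.aestronglyMeasurable
            · exact ae_of_all _ fun u => by
                simpa using norm_charFun_le_one (μ := iterConv τ n) (u * r)
          · rw [charFun_iterConv, norm_pow]
            have h3 := h.norm_charFun_le hB (t := u * r) (mul_nonneg hu.1.le hr0.le)
              (by nlinarith [hu.2])
            refine (pow_le_pow_left₀ (norm_nonneg _) h3 n).trans (le_of_eq ?_)
            rw [← Real.exp_nat_mul]
            congr 1
            rw [hb]
            ring
      _ ≤ _ := setIntegral_mono_set hint (ae_of_all _ fun u => (Real.exp_pos _).le)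
          (Filter.Eventually.of_forall fun u hu => hu.1)
  rw [integral_gaussian_Ioi] at h2
  have h3 : Real.sqrt (Real.pi / b) ≤ 8 / (r * Real.sqrt n) := by
    rw [Real.sqrt_le_left (by positivity), div_pow, mul_pow, Real.sq_sqrt hn0.le, hb]
    rw [div_le_div_iff₀ (by positivity) (by positivity)]
    have := Real.pi_lt_d2
    have h5 : 0 < (n : ℝ) * r ^ 2 := by positivity
    nlinarith
  calc 4 * ∫ u in (0 : ℝ)..1, ‖charFun (iterConv τ n) (u * r)‖
      ≤ 4 * (8 / (r * Real.sqrt n) / 2) := by linarith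
    _ = 128 * B / Real.sqrt n := by
      rw [hr]
      field_simp
      norm_num

lemma CentralMoments.measureReal_iterConv_Ico_le {τ : Measure ℝ} [IsProbabilityMeasure τ]
    {m v B : ℝ} (h : CentralMoments τ m v B) (hB : 1 ≤ B) {n : ℕ} (hn : 1 ≤ n) (a : ℝ) {l : ℝ}
    (hl : 0 ≤ l) :
    (iterConv τ n).real (Set.Ico a (a + l)) ≤ (l + 1) * (128 * B / Real.sqrt n) := by
  have hsub : Set.Ico a (a + l) ⊆
      ⋃ i ∈ Finset.range ⌈l⌉₊, Set.Icc (a + i) (a + i + 1) := by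
    intro y hy
    have h0 : 0 ≤ y - a := by linarith [hy.1]
    have h1 := Nat.floor_le h0
    have h2 := Nat.lt_floor_add_one (y - a)
    simp only [Set.mem_iUnion, Finset.mem_range]
    refine ⟨⌊y - a⌋₊, ?_, by constructor <;> linarith⟩
    rw [Nat.lt_ceil]
    linarith [hy.2]
  calc (iterConv τ n).real (Set.Ico a (a + l))
      ≤ (iterConv τ n).real (⋃ i ∈ Finset.range ⌈l⌉₊, Set.Icc (a + i) (a + i + 1)) :=
        measureReal_mono hsub (measure_ne_top _ _)
    _ ≤ ∑ i ∈ Finset.range ⌈l⌉₊, (iterConv τ n).real (Set.Icc (a + i) (a + i + 1)) :=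
        measureReal_biUnion_finset_le _ _
    _ ≤ ∑ i ∈ Finset.range ⌈l⌉₊, 128 * B / Real.sqrt n :=
        Finset.sum_le_sum fun i _ => h.measureReal_iterConv_Icc_le hB hn _
    _ = ⌈l⌉₊ * (128 * B / Real.sqrt n) := by simp
    _ ≤ _ := by
        gcongr
        exact (Nat.ceil_lt_add_one hl).le

/-! ### Lindeberg comparison with a Gaussian. -/

lemma abs_le_pow_succ_of_abs_deriv_le {h h' : ℝ → ℝ} {B : ℝ} {k : ℕ} (h0 : h 0 = 0)
    (hd : ∀ x, HasDerivAt h (h' x) x) (hb : ∀ x, |h' x| ≤ B * |x| ^ k) (w : ℝ) :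
    |h w| ≤ B * |w| ^ (k + 1) := by
  have hB : 0 ≤ B := by simpa using (abs_nonneg _).trans (hb 1)
  have := (convex_uIcc (0 : ℝ) w).norm_image_sub_le_of_norm_hasDerivWithin_le
    (f := h) (f' := h') (C := B * |w| ^ k) (x := 0) (y := w)
    (fun x _ => (hd x).hasDerivWithinAt) (fun x hx => ?_) Set.left_mem_uIcc Set.right_mem_uIcc
  · simpa [h0, pow_succ, mul_assoc] using this
  · refine (hb x).trans ?_
    have hx' : |x| ≤ |w| := by
      have := Set.abs_sub_left_of_mem_uIcc hx
      simpa using this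
    gcongr

lemma abs_taylor_two_le {g g₁ g₂ g₃ : ℝ → ℝ} {B : ℝ} (h1 : ∀ x, HasDerivAt g (g₁ x) x)
    (h2 : ∀ x, HasDerivAt g₁ (g₂ x) x) (h3 : ∀ x, HasDerivAt g₂ (g₃ x) x) (hB : ∀ x, |g₃ x| ≤ B)
    (u w : ℝ) : |g (u + w) - g u - g₁ u * w - g₂ u * w ^ 2 / 2| ≤ B * |w| ^ 3 := by
  have e2 : ∀ w, |g₂ (u + w) - g₂ u| ≤ B * |w| ^ 1 := by
    refine abs_le_pow_succ_of_abs_deriv_le (h' := fun w => g₃ (u + w)) (by simp) (fun x => ?_)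
      fun x => by simpa using hB (u + x)
    exact ((h3 (u + x)).comp_const_add u x).sub_const _
  have e1 : ∀ w, |g₁ (u + w) - g₁ u - g₂ u * w| ≤ B * |w| ^ 2 := by
    refine abs_le_pow_succ_of_abs_deriv_le (h := fun w => g₁ (u + w) - g₁ u - g₂ u * w)
      (by simp) (fun x => ?_) e2
    have := ((hasDerivAt_id x).const_mul (g₂ u))
    convert! (((h2 (u + x)).comp_const_add u x).sub_const (g₁ u)).sub this using 1
    ring
  refine abs_le_pow_succ_of_abs_deriv_le
    (h := fun w => g (u + w) - g u - g₁ u * w - g₂ u * w ^ 2 / 2) (by simp) (fun x => ?_) e1 w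
  have t1 := ((hasDerivAt_id x).const_mul (g₁ u))
  have t2 := ((hasDerivAt_pow 2 x).const_mul (g₂ u)).div_const 2
  convert! ((((h1 (u + x)).comp_const_add u x).sub_const (g u)).sub t1).sub t2 using 1
  simp
  ring

/-- A bump function on `[-1, 0]` with a global second order Taylor estimate. -/
lemma exists_bump_taylor : ∃ (f f₁ f₂ : ℝ → ℝ) (B : ℝ), 0 ≤ B ∧ Continuous f ∧ (∀ x, 0 ≤ f x) ∧
    (∀ x, f x ≤ 1) ∧ (∀ x, x ∉ Set.Icc (-1 : ℝ) 0 → f x = 0) ∧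
    (∀ x ∈ Set.Icc (-2 / 3 : ℝ) (-1 / 3), f x = 1) ∧
    ∀ u w, |f (u + w) - f u - f₁ u * w - f₂ u * w ^ 2 / 2| ≤ B * |w| ^ 3 := by
  let φ : ContDiffBump (-1 / 2 : ℝ) := ⟨1 / 6, 1 / 2, by norm_num, by norm_num⟩
  have hc : ContDiff ℝ 3 φ := φ.contDiff
  have hs : HasCompactSupport φ := φ.hasCompactSupport
  have hc1 : ContDiff ℝ 2 (deriv φ) := (contDiff_succ_iff_deriv.1 hc).2.2
  have hc2 : ContDiff ℝ 1 (deriv (deriv φ)) := (contDiff_succ_iff_deriv.1 hc1).2.2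
  have hc3 : Continuous (deriv (deriv (deriv φ))) := hc2.continuous_deriv le_rfl
  obtain ⟨B, hB⟩ := hs.deriv.deriv.deriv.exists_bound_of_continuous hc3
  refine ⟨φ, deriv φ, deriv (deriv φ), B, (norm_nonneg _).trans (hB 0), φ.continuous,
    fun x => φ.nonneg, fun x => φ.le_one, fun x hx => ?_, fun x hx => ?_, ?_⟩
  · refine φ.zero_of_le_dist ?_
    change (1 / 2 : ℝ) ≤ _
    rw [Real.dist_eq]
    by_contra hlt
    rw [not_le, abs_lt] at hlt
    exact hx ⟨by linarith [hlt.1], by linarith [hlt.2]⟩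
  · refine φ.one_of_mem_closedBall ?_
    change dist _ _ ≤ (1 / 6 : ℝ)
    rw [Real.dist_eq, abs_le]
    constructor <;> linarith [hx.1, hx.2]
  · exact abs_taylor_two_le (fun x => (hc.differentiable (by norm_num) x).hasDerivAt)
      (fun x => (hc1.differentiable (by norm_num) x).hasDerivAt)
      (fun x => (hc2.differentiable (by norm_num) x).hasDerivAt) hB

/-- Lindeberg's replacement argument for convolution powers. -/
lemma abs_integral_iterConv_sub_le {τ γ : Measure ℝ} [IsProbabilityMeasure τ]
    [IsProbabilityMeasure γ] {f : ℝ → ℝ} (hf : Continuous f) {b ε : ℝ} (hb : ∀ x, |f x| ≤ b)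
    (hε : ∀ x, |∫ y, f (x + y) ∂τ - ∫ y, f (x + y) ∂γ| ≤ ε) (n : ℕ) :
    ∀ x, |∫ y, f (x + y) ∂(iterConv τ n) - ∫ y, f (x + y) ∂(iterConv γ n)| ≤ n * ε := by
  have hint : ∀ (κ : Measure ℝ) [IsProbabilityMeasure κ] (x : ℝ),
      Integrable (fun y => f (x + y)) κ := fun κ _ x =>
    (integrable_const b).mono' (by fun_prop) (ae_of_all _ fun y => hb _)
  have hpr : ∀ (κ κ' : Measure ℝ) [IsProbabilityMeasure κ] [IsProbabilityMeasure κ'] (x : ℝ),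
      Integrable (Function.uncurry fun y z => f (x + (y + z))) (κ.prod κ') := fun κ κ' _ _ x =>
    (integrable_const b).mono' (by fun_prop) (ae_of_all _ fun y => hb _)
  have hL : ∀ (κ κ' : Measure ℝ) [IsProbabilityMeasure κ] [IsProbabilityMeasure κ'] (x : ℝ),
      Integrable (fun y => ∫ z, f (x + (y + z)) ∂κ') κ := fun κ κ' _ _ x =>
    (hpr κ κ' x).integral_prod_left
  have hR : ∀ (κ κ' : Measure ℝ) [IsProbabilityMeasure κ] [IsProbabilityMeasure κ'] (x : ℝ),
      Integrable (fun z => ∫ y, f (x + (y + z)) ∂κ) κ' := fun κ κ' _ _ x =>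
    (hpr κ κ' x).integral_prod_right
  induction n with
  | zero => intro x; simp [iterConv]
  | succ n ih =>
    intro x
    simp only [iterConv]
    rw [integral_conv (hint _ x), integral_conv (hint _ x)]
    -- The intermediate law is `iterConv τ n` convolved with `γ`: replacing the last factor costs
    -- `ε`, and after Fubini the remaining difference is the induction hypothesis at the shifted
    -- points `x + z`.
    have hsw := integral_integral_swap (hpr (iterConv τ n) γ x)
    have hsw' := integral_integral_swap (hpr (iterConv γ n) γ x)
    have d1 : |∫ y, ∫ z, f (x + (y + z)) ∂τ ∂(iterConv τ n)
        - ∫ y, ∫ z, f (x + (y + z)) ∂γ ∂(iterConv τ n)| ≤ ε := by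
      rw [← integral_sub (hL (iterConv τ n) τ x) (hL (iterConv τ n) γ x)]
      have := norm_integral_le_of_norm_le_const (μ := iterConv τ n)
        (f := fun y => ∫ z, f (x + (y + z)) ∂τ - ∫ z, f (x + (y + z)) ∂γ) (C := ε)
        (ae_of_all _ fun y => by simpa [add_assoc] using hε (x + y))
      simpa using this
    have d2 : |∫ y, ∫ z, f (x + (y + z)) ∂γ ∂(iterConv τ n)
        - ∫ y, ∫ z, f (x + (y + z)) ∂γ ∂(iterConv γ n)| ≤ n * ε := by
      rw [hsw, hsw', ← integral_sub (hR (iterConv τ n) γ x) (hR (iterConv γ n) γ x)]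
      have := norm_integral_le_of_norm_le_const (μ := γ)
        (f := fun z => ∫ y, f (x + (y + z)) ∂(iterConv τ n)
          - ∫ y, f (x + (y + z)) ∂(iterConv γ n)) (C := n * ε)
        (ae_of_all _ fun z => by
          have := ih (x + z)
          simpa [add_assoc, add_comm, add_left_comm] using this)
      simpa using this
    push_cast
    calc _ ≤ _ := abs_sub_le _ (∫ y, ∫ z, f (x + (y + z)) ∂γ ∂(iterConv τ n)) _
      _ ≤ (n + 1) * ε := by linarith

/-- Expanding at the mean kills the linear term, and what remains depends on `τ` only through `m`
and `v`; two laws sharing these therefore differ only by third-order errors. -/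
lemma CentralMoments.abs_integral_sub_taylor_le {τ : Measure ℝ} [IsProbabilityMeasure τ]
    {m v A : ℝ} (h : CentralMoments τ m v A) {f f₁ f₂ : ℝ → ℝ} {B c d : ℝ} (hB : 0 ≤ B)
    (hc : 0 ≤ c) (hf : Continuous f) {b : ℝ} (hb : ∀ x, |f x| ≤ b)
    (ht : ∀ u w, |f (u + w) - f u - f₁ u * w - f₂ u * w ^ 2 / 2| ≤ B * |w| ^ 3) (x : ℝ) :
    |∫ y, f (c * (x + y) + d) ∂τ -
      (f (c * (x + m) + d) + f₂ (c * (x + m) + d) * (c ^ 2 * v) / 2)| ≤ B * c ^ 3 * A := by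
  set u := c * (x + m) + d with hu
  have hi : Integrable (fun y => f (c * (x + y) + d)) τ :=
    (integrable_const b).mono' (by fun_prop) (ae_of_all _ fun y => hb _)
  have hp1 : Integrable (fun y => f₁ u * c * (y - m)) τ := h.integrable_sub.const_mul _
  have hp2 : Integrable (fun y => f₂ u * c ^ 2 / 2 * (y - m) ^ 2) τ := h.integrable_sq.const_mul _
  have hq : Integrable (fun y => f u + f₁ u * c * (y - m)) τ := (integrable_const _).add hp1
  have hp : ∫ y, (f u + f₁ u * c * (y - m) + f₂ u * c ^ 2 / 2 * (y - m) ^ 2) ∂τ =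
      f u + f₂ u * (c ^ 2 * v) / 2 := by
    rw [integral_add hq hp2, integral_add (integrable_const _) hp1, integral_const_mul,
      integral_const_mul, h.mean, h.var]
    simp
    ring
  have hqq : Integrable
      (fun y => f u + f₁ u * c * (y - m) + f₂ u * c ^ 2 / 2 * (y - m) ^ 2) τ := hq.add hp2
  rw [← hp, ← integral_sub hi hqq]
  refine abs_integral_le_integral_abs.trans ?_
  calc ∫ y, |f (c * (x + y) + d) -
        (f u + f₁ u * c * (y - m) + f₂ u * c ^ 2 / 2 * (y - m) ^ 2)| ∂τ
      ≤ ∫ y, B * c ^ 3 * |y - m| ^ 3 ∂τ := by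
        refine integral_mono (hi.sub hqq).abs (h.integrable_cube.const_mul _) fun y => ?_
        have h1 := ht u (c * (y - m))
        have h2 : u + c * (y - m) = c * (x + y) + d := by rw [hu]; ring
        rw [h2, abs_mul, abs_of_nonneg hc] at h1
        refine (le_of_eq ?_).trans (h1.trans (le_of_eq (by ring)))
        congr 1
        ring
    _ = B * c ^ 3 * ∫ y, |y - m| ^ 3 ∂τ := integral_const_mul _ _
    _ ≤ _ := by gcongr; exact h.third

lemma abs_cube_le_exp_add_exp (z : ℝ) : |z| ^ 3 ≤ 6 * (Real.exp z + Real.exp (-z)) := by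
  have h1 := Real.pow_div_factorial_le_exp |z| (abs_nonneg z) 3
  have h2 : Real.exp |z| ≤ Real.exp z + Real.exp (-z) := by
    rcases abs_cases z with ⟨h, _⟩ | ⟨h, _⟩ <;> rw [h] <;>
      linarith [Real.exp_pos z, Real.exp_pos (-z)]
  norm_num [Nat.factorial] at h1
  linarith

lemma centralMoments_gaussianReal (m : ℝ) {v : NNReal} (hv1 : 1 / 2 ≤ (v : ℝ))
    (hv2 : (v : ℝ) ≤ 2) : CentralMoments (gaussianReal m v) m v 36 := by
  have hexp : ∀ s : ℝ, Integrable (fun y => Real.exp (s * (y - m))) (gaussianReal m v) ∧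
      ∫ y, Real.exp (s * (y - m)) ∂(gaussianReal m v) = Real.exp (v * s ^ 2 / 2) := by
    intro s
    have e : (fun y : ℝ => Real.exp (s * (y - m))) =
        fun y => Real.exp (-(s * m)) * Real.exp (s * y) := by
      funext y
      rw [← Real.exp_add]
      ring_nf
    have h1 := congrFun (mgf_id_gaussianReal (μ := m) (v := v)) s
    simp only [mgf, id] at h1
    rw [e]
    refine ⟨(integrable_exp_mul_gaussianReal s).const_mul _, ?_⟩
    rw [integral_const_mul, h1, ← Real.exp_add]
    ring_nf
  obtain ⟨i1, e1⟩ := hexp 1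
  obtain ⟨i2, e2⟩ := hexp (-1)
  simp only [one_mul, neg_one_mul, one_pow, mul_one, neg_one_sq] at i1 e1 i2 e2
  have hcube : Integrable (fun y => |y - m| ^ 3) (gaussianReal m v) :=
    ((i1.add i2).const_mul 6).mono' (by fun_prop) (ae_of_all _ fun y => by
      rw [Real.norm_of_nonneg (by positivity)]
      exact abs_cube_le_exp_add_exp _)
  have hid : Integrable (fun y : ℝ => y) (gaussianReal m v) :=
    (memLp_id_gaussianReal (μ := m) (v := v) 1).integrable le_rfl
  refine ⟨hcube, ?_, ?_, hv1, hv2, ?_⟩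
  · rw [integral_sub hid (integrable_const _), integral_id_gaussianReal]
    simp
  · have := variance_id_gaussianReal (μ := m) (v := v)
    rw [variance_eq_integral aemeasurable_id] at this
    simpa [integral_id_gaussianReal] using this
  · calc ∫ y, |y - m| ^ 3 ∂(gaussianReal m v)
        ≤ ∫ y, 6 * (Real.exp (y - m) + Real.exp (-(y - m))) ∂(gaussianReal m v) :=
          integral_mono hcube ((i1.add i2).const_mul 6) fun y => abs_cube_le_exp_add_exp _
      _ = 12 * Real.exp (v / 2) := by
          rw [integral_const_mul, integral_add i1 i2, e1, e2]
          ring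
      _ ≤ 12 * Real.exp 1 := by gcongr; linarith
      _ ≤ 36 := by linarith [Real.exp_one_lt_d9]

lemma le_measureReal_gaussianReal_Icc {m a b : ℝ} {v : NNReal} {N : ℝ} (hN : 0 < N)
    (hv1 : N / 2 ≤ v) (hv2 : v ≤ 2 * N) (hab : a ≤ b)
    (hm : ∀ y ∈ Set.Icc a b, |y - m| ≤ 2 * Real.sqrt N) :
    Real.exp (-4) / (4 * Real.sqrt N) * (b - a) ≤ (gaussianReal m v).real (Set.Icc a b) := by
  have hv0 : (0 : ℝ) < v := by linarith
  have hv : v ≠ 0 := by rintro rfl; simp at hv0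
  have hsN := Real.sqrt_pos.2 hN
  rw [measureReal_def, gaussianReal_apply_eq_integral _ hv,
    ENNReal.toReal_ofReal (integral_nonneg fun x => gaussianPDFReal_nonneg _ _ _)]
  have hc : ∫ _ in Set.Icc a b, Real.exp (-4) / (4 * Real.sqrt N) =
      Real.exp (-4) / (4 * Real.sqrt N) * (b - a) := by
    rw [setIntegral_const, measureReal_def, Real.volume_Icc, ENNReal.toReal_ofReal (by linarith)]
    rw [smul_eq_mul, mul_comm]
  rw [← hc]
  refine setIntegral_mono_on (by simp) (integrable_gaussianPDFReal _ _).integrableOn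
    measurableSet_Icc fun y hy => ?_
  rw [gaussianPDFReal]
  have h1 : Real.sqrt (2 * Real.pi * v) ≤ 4 * Real.sqrt N := by
    rw [Real.sqrt_le_left (by positivity), mul_pow, Real.sq_sqrt hN.le]
    nlinarith [Real.pi_lt_d2, Real.pi_gt_three]
  have h2 : -4 ≤ -(y - m) ^ 2 / (2 * v) := by
    rw [le_div_iff₀ (by positivity)]
    have := hm y hy
    rw [← sq_le_sq₀ (abs_nonneg _) (by positivity), sq_abs, mul_pow, Real.sq_sqrt hN.le] at this
    linarith
  rw [div_eq_inv_mul]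
  gcongr

/-- A lower bound for the mass that a convolution power gives to a short interval near its mean. -/
lemma exists_le_measureReal_iterConv_Icc (A : ℝ) : ∃ η : ℝ, 0 < η ∧
    ∀ (τ : Measure ℝ) [IsProbabilityMeasure τ] (m v : ℝ), CentralMoments τ m v A →
    ∀ (n : ℕ) (l : ℝ), 1 ≤ n → 2 ≤ l → l ^ 4 ≤ η * Real.sqrt n →
    |n * m + Real.sqrt n * l| ≤ Real.sqrt n →
    Real.exp (-4) / (24 * l) ≤ (iterConv τ n).real
      (Set.Icc (Real.sqrt n * (-l - 1 / l)) (Real.sqrt n * (-l))) := by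
  obtain ⟨f, f₁, f₂, B, hB, hf, hf0, hf1, hfz, hfo, ht⟩ := exists_bump_taylor
  set Q := B * (|A| + 36) with hQ
  have hQ0 : 0 ≤ Q := by positivity
  -- With this `η` the total Lindeberg error `n * Q * c ^ 3` is at most `exp (-4) / (24 * l)`, half
  -- of the Gaussian mass found below.
  refine ⟨Real.exp (-4) / 24 / (Q + 1), by positivity, fun τ _ m v h n l hn hl hη hm => ?_⟩
  have hn0 : (0 : ℝ) < n := by exact_mod_cast hn
  set r := Real.sqrt n with hr
  have hr0 : 0 < r := Real.sqrt_pos.2 hn0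
  have hrr : r * r = n := Real.mul_self_sqrt hn0.le
  have hl0 : 0 < l := by linarith
  -- The map `y ↦ c * y + l ^ 2` carries the target window onto `[-1, 0]`, the interval outside
  -- which the bump vanishes.
  set c := l / r with hcdef
  have hc0 : 0 < c := by positivity
  have hb : ∀ x, |f x| ≤ 1 := fun x => by rw [abs_of_nonneg (hf0 x)]; exact hf1 x
  lift v to NNReal using by linarith [h.half_le]
  have hγ := centralMoments_gaussianReal m h.half_le h.le_two
  have hstep : ∀ x, |∫ y, f (c * (x + y) + l ^ 2) ∂τ
      - ∫ y, f (c * (x + y) + l ^ 2) ∂(gaussianReal m v)| ≤ Q * c ^ 3 := by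
    intro x
    have h1 := h.abs_integral_sub_taylor_le (d := l ^ 2) hB hc0.le hf hb ht x
    have h2 := hγ.abs_integral_sub_taylor_le (d := l ^ 2) hB hc0.le hf hb ht x
    rw [abs_sub_comm] at h2
    refine (abs_sub_le _ _ _).trans ((add_le_add h1 h2).trans ?_)
    have : B * c ^ 3 * A ≤ B * c ^ 3 * |A| := by gcongr; exact le_abs_self A
    rw [hQ]
    linarith
  have hlind := abs_integral_iterConv_sub_le (f := fun y => f (c * y + l ^ 2)) (by fun_prop)
    (fun x => hb _) hstep n 0
  simp only [zero_add] at hlind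
  have hQc : n * (Q * c ^ 3) ≤ Real.exp (-4) / (24 * l) := by
    have h1 : n * (Q * c ^ 3) = Q * (l ^ 4 / r) / l := by
      rw [hcdef, ← hrr]
      field_simp
    have h2 : l ^ 4 / r ≤ Real.exp (-4) / 24 / (Q + 1) := by rwa [div_le_iff₀ hr0]
    have h3 : Q * (l ^ 4 / r) ≤ Real.exp (-4) / 24 := by
      calc Q * (l ^ 4 / r) ≤ (Q + 1) * (Real.exp (-4) / 24 / (Q + 1)) := by
            gcongr
            linarith
        _ = _ := by field_simp
    rw [h1, ← div_div]
    gcongr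
  have hup : ∫ y, f (c * y + l ^ 2) ∂(iterConv τ n) ≤
      (iterConv τ n).real (Set.Icc (r * (-l - 1 / l)) (r * (-l))) := by
    rw [← integral_indicator_one measurableSet_Icc]
    refine integral_mono ((integrable_const (1 : ℝ)).mono' (by fun_prop)
      (ae_of_all _ fun y => hb _)) ((integrable_const _).indicator measurableSet_Icc) fun y => ?_
    by_cases hy : y ∈ Set.Icc (r * (-l - 1 / l)) (r * (-l))
    · rw [Set.indicator_of_mem hy]
      exact hf1 _
    · rw [Set.indicator_of_notMem hy]
      refine (hfz _ fun hz => hy ?_).le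
      have e : y = (c * y + l ^ 2) * (r / l) - r * l := by rw [hcdef]; field_simp; ring
      have hrl : 0 < r / l := by positivity
      constructor
      · have : r * (-l - 1 / l) = (-1) * (r / l) - r * l := by field_simp; ring
        rw [this, e]
        nlinarith [hz.1]
      · rw [e]
        nlinarith [hz.2]
  -- The middle third of the window is where the bump equals `1`.
  have hg1 : (iterConv (gaussianReal m v) n).real
      (Set.Icc (r * (-l - 2 / (3 * l))) (r * (-l - 1 / (3 * l)))) ≤
      ∫ y, f (c * y + l ^ 2) ∂(iterConv (gaussianReal m v) n) := by
    rw [← integral_indicator_one measurableSet_Icc]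
    refine integral_mono ((integrable_const _).indicator measurableSet_Icc)
      ((integrable_const (1 : ℝ)).mono' (by fun_prop) (ae_of_all _ fun y => hb _)) fun y => ?_
    by_cases hy : y ∈ Set.Icc (r * (-l - 2 / (3 * l))) (r * (-l - 1 / (3 * l)))
    · rw [Set.indicator_of_mem hy]
      refine (hfo _ ?_).ge
      have e1 : c * (r * (-l - 2 / (3 * l))) + l ^ 2 = -2 / 3 := by
        rw [hcdef]; field_simp; ring
      have e2 : c * (r * (-l - 1 / (3 * l))) + l ^ 2 = -1 / 3 := by
        rw [hcdef]; field_simp; ring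
      have := mul_le_mul_of_nonneg_left hy.1 hc0.le
      have := mul_le_mul_of_nonneg_left hy.2 hc0.le
      constructor <;> linarith
    · rw [Set.indicator_of_notMem hy]
      exact hf0 _
  have hg2 : Real.exp (-4) / (4 * r) *
      (r * (-l - 1 / (3 * l)) - r * (-l - 2 / (3 * l))) ≤ (iterConv (gaussianReal m v) n).real
      (Set.Icc (r * (-l - 2 / (3 * l))) (r * (-l - 1 / (3 * l)))) := by
    rw [iterConv_gaussianReal]
    have h12 : 1 / (3 * l) ≤ 2 / (3 * l) := by gcongr; norm_num
    have h21 : 2 / (3 * l) ≤ 1 := by rw [div_le_one (by positivity)]; linarith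
    have h10 : 0 < 1 / (3 * l) := by positivity
    refine le_measureReal_gaussianReal_Icc hn0 ?_ ?_ (by gcongr) fun y hy => ?_
    · push_cast
      nlinarith [h.half_le]
    · push_cast
      nlinarith [h.le_two]
    · rw [← hr]
      have e : y - n * m = (y + r * l) - (n * m + r * l) := by ring
      rw [e]
      refine (abs_sub _ _).trans ?_
      have : |y + r * l| ≤ r := by
        rw [abs_le]
        constructor
        · nlinarith [hy.1]
        · nlinarith [hy.2]
      linarith
  have hg3 : Real.exp (-4) / (4 * r) * (r * (-l - 1 / (3 * l)) - r * (-l - 2 / (3 * l))) =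
      2 * (Real.exp (-4) / (24 * l)) := by
    field_simp
    ring
  have := (abs_le.1 hlind).1
  linarith

/-! ### Subgaussian laws and their tilts. -/

/-- `ν` is standardized (mean `0`, variance `1`) and `𝔼 exp (x² / K²) ≤ 2`. -/
structure StdSubgaussian (ν : Measure ℝ) (K : ℝ) : Prop where
  pos : 0 < K
  integrable_exp : Integrable (fun x => Real.exp (x ^ 2 / K ^ 2)) ν
  integral_exp_le : ∫ x, Real.exp (x ^ 2 / K ^ 2) ∂ν ≤ 2
  mean : ∫ x, x ∂ν = 0
  var : ∫ x, x ^ 2 ∂ν = 1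

lemma abs_exp_sub_one_le (u : ℝ) : |Real.exp u - 1| ≤ |u| * Real.exp |u| := by
  have h := Complex.norm_exp_sub_sum_le_norm_mul_exp (u : ℂ) 1
  simp only [Finset.range_one, Finset.sum_singleton, pow_zero, Nat.factorial_zero, Nat.cast_one,
    div_one, pow_one, Complex.norm_real, Real.norm_eq_abs] at h
  rwa [← Complex.ofReal_exp, ← Complex.ofReal_one, ← Complex.ofReal_sub, Complex.norm_real,
    Real.norm_eq_abs] at h

lemma abs_exp_sub_one_sub_le (u : ℝ) : |Real.exp u - 1 - u| ≤ |u| ^ 2 * Real.exp |u| := by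
  have h := Complex.norm_exp_sub_sum_le_norm_mul_exp (u : ℂ) 2
  have e : Complex.exp u - ∑ m ∈ Finset.range 2, (u : ℂ) ^ m / m.factorial =
      ((Real.exp u - 1 - u : ℝ) : ℂ) := by
    simp [Finset.sum_range_succ]
    ring
  rwa [e, Complex.norm_real, Complex.norm_real, Real.norm_eq_abs, Real.norm_eq_abs] at h

namespace StdSubgaussian

variable {ν : Measure ℝ} {K : ℝ}

/-- The power is absorbed into a second `exp |x|`, and then `2 * |x| ≤ K ^ 2 + x ^ 2 / K ^ 2`. -/
lemma pow_mul_exp_le (hK : 0 < K) {k : ℕ} (hk : k ≤ 4) (x : ℝ) :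
    |x| ^ k * Real.exp |x| ≤ 24 * Real.exp (K ^ 2) * Real.exp (x ^ 2 / K ^ 2) := by
  have h1 := Real.pow_div_factorial_le_exp |x| (abs_nonneg x) k
  have h2 : (k.factorial : ℝ) ≤ 24 := by exact_mod_cast Nat.factorial_le hk
  have h3 : |x| ^ k ≤ 24 * Real.exp |x| := by
    rw [div_le_iff₀ (by positivity)] at h1
    nlinarith [Real.exp_pos |x|]
  have h4 : |x| + |x| ≤ K ^ 2 + x ^ 2 / K ^ 2 := by
    have h5 : x ^ 2 / K ^ 2 = (|x| / K) ^ 2 := by rw [div_pow, sq_abs]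
    have h6 : |x| = K * (|x| / K) := by field_simp
    rw [h5]
    nlinarith [sq_nonneg (K - |x| / K), sq_nonneg (1 - |x| / K), sq_nonneg K, sq_nonneg (|x| / K)]
  calc |x| ^ k * Real.exp |x| ≤ 24 * Real.exp |x| * Real.exp |x| := by gcongr
    _ = 24 * Real.exp (|x| + |x|) := by rw [Real.exp_add]; ring
    _ ≤ 24 * Real.exp (K ^ 2 + x ^ 2 / K ^ 2) := by gcongr
    _ = _ := by rw [Real.exp_add]; ring

lemma integrable_pow_mul_exp (h : StdSubgaussian ν K) {k : ℕ} (hk : k ≤ 4) :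
    Integrable (fun x => |x| ^ k * Real.exp |x|) ν :=
  (h.integrable_exp.const_mul (24 * Real.exp (K ^ 2))).mono' (by fun_prop) (ae_of_all _ fun x => by
    rw [Real.norm_of_nonneg (by positivity)]
    exact pow_mul_exp_le h.pos hk x)

lemma integral_pow_mul_exp_le (h : StdSubgaussian ν K) {k : ℕ} (hk : k ≤ 4) :
    ∫ x, |x| ^ k * Real.exp |x| ∂ν ≤ 48 * Real.exp (K ^ 2) := by
  calc ∫ x, |x| ^ k * Real.exp |x| ∂ν
      ≤ ∫ x, 24 * Real.exp (K ^ 2) * Real.exp (x ^ 2 / K ^ 2) ∂ν :=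
        integral_mono (h.integrable_pow_mul_exp hk) (h.integrable_exp.const_mul _)
          fun x => pow_mul_exp_le h.pos hk x
    _ = 24 * Real.exp (K ^ 2) * ∫ x, Real.exp (x ^ 2 / K ^ 2) ∂ν := integral_const_mul _ _
    _ ≤ 24 * Real.exp (K ^ 2) * 2 := by gcongr; exact h.integral_exp_le
    _ = _ := by ring

lemma neg_mul_le_abs {s : ℝ} (hs : |s| ≤ 1) (x : ℝ) : -s * x ≤ |x| := by
  refine (le_abs_self _).trans ?_
  rw [abs_mul, abs_neg]
  nlinarith [abs_nonneg x]

lemma integrable_pow_mul_exp_mul (h : StdSubgaussian ν K) {k : ℕ} (hk : k ≤ 4) {s : ℝ}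
    (hs : |s| ≤ 1) : Integrable (fun x => x ^ k * Real.exp (-s * x)) ν :=
  (h.integrable_pow_mul_exp hk).mono' (by fun_prop) (ae_of_all _ fun x => by
    rw [norm_mul, norm_pow, Real.norm_eq_abs, Real.norm_of_nonneg (Real.exp_pos _).le]
    gcongr
    exact neg_mul_le_abs hs x)

lemma integrable_pow (h : StdSubgaussian ν K) {k : ℕ} (hk : k ≤ 4) :
    Integrable (fun x => x ^ k) ν := by
  simpa using h.integrable_pow_mul_exp_mul hk (s := 0) (by simp)

lemma integrable_exp_mul (h : StdSubgaussian ν K) {s : ℝ} (hs : |s| ≤ 1) :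
    Integrable (fun x => Real.exp (-s * x)) ν := by
  simpa using h.integrable_pow_mul_exp_mul (k := 0) (by norm_num) hs

/-- Mean zero removes the linear Taylor term, and the remainder is dominated by `|x| ^ k * exp |x|`.
The next two lemmas expand the first and second tilted moments in the same way. -/
lemma abs_integral_exp_sub_one_le [IsProbabilityMeasure ν] (h : StdSubgaussian ν K) {s : ℝ} (hs : |s| ≤ 1) :
    |∫ x, Real.exp (-s * x) ∂ν - 1| ≤ s ^ 2 * (48 * Real.exp (K ^ 2)) := by
  have hx : Integrable (fun x : ℝ => x) ν := by simpa using h.integrable_pow (k := 1) (by norm_num)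
  have hi := h.integrable_exp_mul hs
  have i1 : Integrable (fun x => Real.exp (-s * x) - 1) ν := hi.sub (integrable_const _)
  have e : ∫ x, Real.exp (-s * x) ∂ν - 1 = ∫ x, (Real.exp (-s * x) - 1 - -s * x) ∂ν := by
    rw [integral_sub i1 (hx.const_mul _), integral_sub hi (integrable_const _),
      integral_const_mul, h.mean]
    simp
  rw [e]
  calc |∫ x, (Real.exp (-s * x) - 1 - -s * x) ∂ν|
      ≤ ∫ x, |Real.exp (-s * x) - 1 - -s * x| ∂ν := abs_integral_le_integral_abs
    _ ≤ ∫ x, s ^ 2 * (|x| ^ 2 * Real.exp |x|) ∂ν := by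
        refine integral_mono (i1.sub (hx.const_mul _)).abs
          ((h.integrable_pow_mul_exp (by norm_num)).const_mul _) fun x => ?_
        refine (abs_exp_sub_one_sub_le _).trans ?_
        rw [abs_mul, abs_neg, mul_pow, sq_abs s, mul_assoc]
        gcongr
        nlinarith [abs_nonneg x]
    _ = s ^ 2 * ∫ x, |x| ^ 2 * Real.exp |x| ∂ν := integral_const_mul _ _
    _ ≤ _ := by gcongr; exact h.integral_pow_mul_exp_le (by norm_num)

lemma abs_integral_mul_exp_add_le (h : StdSubgaussian ν K) {s : ℝ} (hs : |s| ≤ 1) :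
    |∫ x, x * Real.exp (-s * x) ∂ν + s| ≤ s ^ 2 * (48 * Real.exp (K ^ 2)) := by
  have hx : Integrable (fun x : ℝ => x) ν := by simpa using h.integrable_pow (k := 1) (by norm_num)
  have hx2 : Integrable (fun x : ℝ => x ^ 2) ν := h.integrable_pow (by norm_num)
  have hi : Integrable (fun x => x * Real.exp (-s * x)) ν := by
    simpa using h.integrable_pow_mul_exp_mul (k := 1) (by norm_num) hs
  have i1 : Integrable (fun x => x * Real.exp (-s * x) - x) ν := hi.sub hx
  have e : ∫ x, x * Real.exp (-s * x) ∂ν + s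
      = ∫ x, (x * Real.exp (-s * x) - x - -s * x ^ 2) ∂ν := by
    rw [integral_sub i1 (hx2.const_mul _), integral_sub hi hx, integral_const_mul, h.mean, h.var]
    ring
  rw [e]
  calc |∫ x, (x * Real.exp (-s * x) - x - -s * x ^ 2) ∂ν|
      ≤ ∫ x, |x * Real.exp (-s * x) - x - -s * x ^ 2| ∂ν := abs_integral_le_integral_abs
    _ ≤ ∫ x, s ^ 2 * (|x| ^ 3 * Real.exp |x|) ∂ν := by
        refine integral_mono (i1.sub (hx2.const_mul _)).abs
          ((h.integrable_pow_mul_exp (by norm_num)).const_mul _) fun x => ?_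
        have e2 : x * Real.exp (-s * x) - x - -s * x ^ 2
          = x * (Real.exp (-s * x) - 1 - -s * x) := by ring
        simp only
        rw [e2, abs_mul]
        have h1 := abs_exp_sub_one_sub_le (-s * x)
        rw [abs_mul, abs_neg, mul_pow, sq_abs s] at h1
        have h2 : Real.exp (|s| * |x|) ≤ Real.exp |x| := by
          gcongr
          nlinarith [abs_nonneg x]
        calc |x| * |Real.exp (-s * x) - 1 - -s * x|
            ≤ |x| * (s ^ 2 * |x| ^ 2 * Real.exp (|s| * |x|)) := by gcongr
          _ ≤ |x| * (s ^ 2 * |x| ^ 2 * Real.exp |x|) := by gcongr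
          _ = _ := by ring
    _ = s ^ 2 * ∫ x, |x| ^ 3 * Real.exp |x| ∂ν := integral_const_mul _ _
    _ ≤ _ := by gcongr; exact h.integral_pow_mul_exp_le (by norm_num)

lemma abs_integral_sq_mul_exp_sub_one_le (h : StdSubgaussian ν K) {s : ℝ} (hs : |s| ≤ 1) :
    |∫ x, x ^ 2 * Real.exp (-s * x) ∂ν - 1| ≤ |s| * (48 * Real.exp (K ^ 2)) := by
  have hx2 : Integrable (fun x : ℝ => x ^ 2) ν := h.integrable_pow (by norm_num)
  have hi : Integrable (fun x => x ^ 2 * Real.exp (-s * x)) ν :=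
    h.integrable_pow_mul_exp_mul (by norm_num) hs
  rw [← h.var, ← integral_sub hi hx2]
  calc |∫ x, (x ^ 2 * Real.exp (-s * x) - x ^ 2) ∂ν|
      ≤ ∫ x, |x ^ 2 * Real.exp (-s * x) - x ^ 2| ∂ν := abs_integral_le_integral_abs
    _ ≤ ∫ x, |s| * (|x| ^ 3 * Real.exp |x|) ∂ν := by
        refine integral_mono (hi.sub hx2).abs
          ((h.integrable_pow_mul_exp (by norm_num)).const_mul _) fun x => ?_
        have e2 : x ^ 2 * Real.exp (-s * x) - x ^ 2 = x ^ 2 * (Real.exp (-s * x) - 1) := by ring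
        simp only
        rw [e2, abs_mul, abs_pow]
        have h1 := abs_exp_sub_one_le (-s * x)
        rw [abs_mul, abs_neg] at h1
        have h2 : Real.exp (|s| * |x|) ≤ Real.exp |x| := by
          gcongr
          nlinarith [abs_nonneg x]
        calc |x| ^ 2 * |Real.exp (-s * x) - 1|
            ≤ |x| ^ 2 * (|s| * |x| * Real.exp (|s| * |x|)) := by gcongr
          _ ≤ |x| ^ 2 * (|s| * |x| * Real.exp |x|) := by gcongr
          _ = _ := by ring
    _ = |s| * ∫ x, |x| ^ 3 * Real.exp |x| ∂ν := integral_const_mul _ _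
    _ ≤ _ := by gcongr; exact h.integral_pow_mul_exp_le (by norm_num)

lemma integral_tilted_eq (s : ℝ) (g : ℝ → ℝ) :
    ∫ x, g x ∂(ν.tilted fun x => -s * x) =
      (∫ x, g x * Real.exp (-s * x) ∂ν) / ∫ x, Real.exp (-s * x) ∂ν := by
  rw [integral_tilted, ← integral_div]
  refine integral_congr_ae (ae_of_all _ fun x => ?_)
  simp only [smul_eq_mul]
  ring

lemma integrable_tilted (h : StdSubgaussian ν K) {s : ℝ} (hs : |s| ≤ 1) {g : ℝ → ℝ}
    (hg : Measurable g) {C : ℝ} {k : ℕ} (hk : k ≤ 4) (hC : ∀ x, |g x| ≤ C * |x| ^ k) :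
    Integrable g (ν.tilted fun x => -s * x) := by
  rw [integrable_tilted_iff (h.integrable_exp_mul hs)]
  refine ((h.integrable_pow_mul_exp hk).const_mul C).mono' (by fun_prop) (ae_of_all _ fun x => ?_)
  rw [norm_smul, Real.norm_of_nonneg (Real.exp_pos _).le, Real.norm_eq_abs, mul_comm]
  calc |g x| * Real.exp (-s * x) ≤ (C * |x| ^ k) * Real.exp |x| :=
        mul_le_mul (hC x) (Real.exp_le_exp.2 (neg_mul_le_abs hs x)) (Real.exp_pos _).le ((abs_nonneg _).trans (hC x))
    _ = _ := by ring

/-- Moments of the tilted measure for small tilts. -/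
lemma exists_centralMoments_tilted [IsProbabilityMeasure ν] (h : StdSubgaussian ν K) {s : ℝ} (hs0 : 0 ≤ s)
    (hs : 16 * (48 * Real.exp (K ^ 2)) * s ≤ 1) :
    ∃ m v, CentralMoments (ν.tilted fun x => -s * x) m v (16 * (48 * Real.exp (K ^ 2))) ∧
      |m + s| ≤ 4 * (48 * Real.exp (K ^ 2)) * s ^ 2 := by
  set A := 48 * Real.exp (K ^ 2) with hA
  have hA1 : 48 ≤ A := by
    have := Real.one_le_exp (sq_nonneg K)
    rw [hA]; linarith
  have hs1 : s ≤ 1 / 768 := by nlinarith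
  have hsabs : |s| ≤ 1 := by rw [abs_of_nonneg hs0]; linarith
  have hi := h.integrable_exp_mul hsabs
  have hp : IsProbabilityMeasure (ν.tilted fun x => -s * x) := isProbabilityMeasure_tilted hi
  have z1 := h.abs_integral_exp_sub_one_le hsabs
  have n1 := h.abs_integral_mul_exp_add_le hsabs
  have n2 := h.abs_integral_sq_mul_exp_sub_one_le hsabs
  have c3 : ∫ x, |x| ^ 3 * Real.exp (-s * x) ∂ν ≤ A := by
    refine le_trans (integral_mono_of_nonneg (ae_of_all _ fun x => by positivity)
      (h.integrable_pow_mul_exp (by norm_num : 3 ≤ 4)) (ae_of_all _ fun x => ?_))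
      (h.integral_pow_mul_exp_le (by norm_num : 3 ≤ 4))
    simp only
    gcongr
    exact neg_mul_le_abs hsabs x
  have c30 : 0 ≤ ∫ x, |x| ^ 3 * Real.exp (-s * x) ∂ν := integral_nonneg fun x => by positivity
  rw [abs_of_nonneg hs0] at n2
  rw [← hA] at z1 n1 n2
  set τ := ν.tilted fun x => -s * x with hτ
  set Z := ∫ x, Real.exp (-s * x) ∂ν with hZ
  set N₁ := ∫ x, x * Real.exp (-s * x) ∂ν with hN₁
  set N₂ := ∫ x, x ^ 2 * Real.exp (-s * x) ∂ν with hN₂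
  have hsA : s * A ≤ 1 / 16 := by linarith
  have hssA : s ^ 2 * A ≤ 1 / 16 * s := by nlinarith
  rw [abs_le] at z1 n1 n2
  have hZ1 : 15 / 16 ≤ Z := by linarith [z1.1]
  have hZ2 : Z ≤ 17 / 16 := by linarith [z1.2]
  have hZ0 : 0 < Z := by linarith
  have t1 : ∫ x, x ∂τ = N₁ / Z := integral_tilted_eq s fun x => x
  have t2 : ∫ x, x ^ 2 ∂τ = N₂ / Z := integral_tilted_eq s fun x => x ^ 2
  have t3 : ∫ x, |x| ^ 3 ∂τ ≤ 2 * A := by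
    rw [integral_tilted_eq s fun x => |x| ^ 3, div_le_iff₀ hZ0]
    nlinarith
  have j1 : Integrable (fun x : ℝ => x) τ :=
    h.integrable_tilted hsabs measurable_id (C := 1) (k := 1) (by norm_num) (by simp)
  have j2 : Integrable (fun x : ℝ => x ^ 2) τ :=
    h.integrable_tilted hsabs (by fun_prop) (C := 1) (k := 2) (by norm_num) (by simp)
  have j3 : Integrable (fun x : ℝ => |x| ^ 3) τ :=
    h.integrable_tilted hsabs (by fun_prop) (C := 1) (k := 3) (by norm_num) (by simp)
  set m := N₁ / Z with hm
  have hms : |m + s| ≤ 4 * A * s ^ 2 := by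
    -- Both `N₁ + s` and `s * (Z - 1)` are of order `s ^ 2`.
    have e : m + s = (N₁ + s + s * (Z - 1)) / Z := by rw [hm]; field_simp; ring
    rw [e, abs_div, abs_of_pos hZ0, div_le_iff₀ hZ0, abs_le]
    have h5 : 0 ≤ s ^ 2 * A := by positivity
    constructor <;> nlinarith
  have hm1 : |m| ≤ 1 / 8 := by
    have : 4 * A * s ^ 2 ≤ 1 / 4 * s := by linarith
    have e : m = (m + s) - s := by ring
    rw [e]
    refine (abs_sub _ _).trans ?_
    rw [abs_of_nonneg hs0]
    linarith
  have hm2 : m ^ 2 ≤ 1 / 64 := by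
    rw [← sq_abs]
    nlinarith [abs_nonneg m]
  have hcube : ∀ y : ℝ, |y - m| ^ 3 ≤ 4 * |y| ^ 3 + 4 := by
    intro y
    have h1 : |y - m| ≤ |y| + 1 := (abs_sub _ _).trans (by linarith)
    have h2 := abs_nonneg y
    calc |y - m| ^ 3 ≤ (|y| + 1) ^ 3 := by gcongr
      _ ≤ 4 * |y| ^ 3 + 4 := by nlinarith [mul_nonneg (add_nonneg h2 zero_le_one) (sq_nonneg (|y| - 1))]
  have j3' : Integrable (fun y => 4 * |y| ^ 3 + 4) τ := (j3.const_mul 4).add (integrable_const _)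
  have jc : Integrable (fun y => |y - m| ^ 3) τ :=
    j3'.mono' (by fun_prop) (ae_of_all _ fun y => by
      rw [Real.norm_of_nonneg (by positivity)]
      exact hcube y)
  have hvar : ∫ y, (y - m) ^ 2 ∂τ = N₂ / Z - m ^ 2 := by
    have e : ∀ y : ℝ, (y - m) ^ 2 = y ^ 2 - 2 * m * y + m ^ 2 := fun y => by ring
    have j4 : Integrable (fun y : ℝ => y ^ 2 - 2 * m * y) τ := j2.sub (j1.const_mul _)
    simp_rw [e]
    rw [integral_add j4 (integrable_const _), integral_sub j2 (j1.const_mul _),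
      integral_const_mul, t1, t2]
    simp
    ring
  refine ⟨m, N₂ / Z - m ^ 2, ⟨jc, ?_, hvar, ?_, ?_, ?_⟩, hms⟩
  · rw [integral_sub j1 (integrable_const _), t1]
    simp
  · have : 3 / 4 ≤ N₂ / Z := by
      rw [le_div_iff₀ hZ0]
      linarith [n2.1]
    linarith
  · have : N₂ / Z ≤ 2 := by
      rw [div_le_iff₀ hZ0]
      linarith [n2.2]
    linarith [sq_nonneg m]
  · calc ∫ y, |y - m| ^ 3 ∂τ ≤ ∫ y, (4 * |y| ^ 3 + 4) ∂τ := integral_mono jc j3' hcube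
      _ = 4 * ∫ y, |y| ^ 3 ∂τ + 4 := by
          rw [integral_add (j3.const_mul 4) (integrable_const _), integral_const_mul]
          simp
      _ ≤ 16 * A := by linarith

end StdSubgaussian

namespace StdSubgaussian

variable {ν : Measure ℝ} [IsProbabilityMeasure ν] {K : ℝ}

lemma neg_mul_le_sq (hK : 0 < K) (s x : ℝ) : -s * x ≤ K ^ 2 * s ^ 2 / 4 + x ^ 2 / K ^ 2 := by
  have h5 : x ^ 2 / K ^ 2 = (x / K) ^ 2 := (div_pow _ _ _).symm
  have h6 : -s * x = -(K * s) * (x / K) := by field_simp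
  rw [h5, h6]
  nlinarith [sq_nonneg (K * s / 2 + x / K)]

omit [IsProbabilityMeasure ν] in
lemma integrable_exp_neg_mul (h : StdSubgaussian ν K) (s : ℝ) :
    Integrable (fun x => Real.exp (-s * x)) ν :=
  (h.integrable_exp.const_mul (Real.exp (K ^ 2 * s ^ 2 / 4))).mono' (by fun_prop)
    (ae_of_all _ fun x => by
      rw [Real.norm_of_nonneg (Real.exp_pos _).le, ← Real.exp_add]
      exact Real.exp_le_exp.2 (neg_mul_le_sq h.pos s x))

/-- Small `s` is covered by the second-order expansion. For `|s| > 1`, completing the square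
suffices, the extra factor `2 ≤ exp 1` being absorbed because `s ^ 2 ≥ 1`. -/
lemma integral_exp_neg_mul_le (h : StdSubgaussian ν K) (s : ℝ) :
    ∫ x, Real.exp (-s * x) ∂ν ≤ Real.exp (48 * Real.exp (K ^ 2) * s ^ 2) := by
  by_cases hs : |s| ≤ 1
  · have h1 := (abs_le.1 (h.abs_integral_exp_sub_one_le hs)).2
    have h2 := Real.add_one_le_exp (48 * Real.exp (K ^ 2) * s ^ 2)
    linarith
  · have hs1 : 1 ≤ s ^ 2 := by rw [← sq_abs]; nlinarith
    have hK := Real.add_one_le_exp (K ^ 2)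
    have hK2 := sq_nonneg K
    calc ∫ x, Real.exp (-s * x) ∂ν
        ≤ ∫ x, Real.exp (K ^ 2 * s ^ 2 / 4) * Real.exp (x ^ 2 / K ^ 2) ∂ν := by
          refine integral_mono (h.integrable_exp_neg_mul s) (h.integrable_exp.const_mul _)
            fun x => ?_
          simp only
          rw [← Real.exp_add]
          exact Real.exp_le_exp.2 (neg_mul_le_sq h.pos s x)
      _ = Real.exp (K ^ 2 * s ^ 2 / 4) * ∫ x, Real.exp (x ^ 2 / K ^ 2) ∂ν := integral_const_mul _ _
      _ ≤ Real.exp (K ^ 2 * s ^ 2 / 4) * Real.exp 1 := by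
          gcongr
          linarith [h.integral_exp_le, Real.add_one_le_exp (1 : ℝ)]
      _ = Real.exp (K ^ 2 * s ^ 2 / 4 + 1) := (Real.exp_add _ _).symm
      _ ≤ _ := by
          gcongr
          nlinarith

/-- Chernoff's bound for the lower tail of a normalized convolution power. -/
lemma measureReal_iterConv_Iic_le (h : StdSubgaussian ν K) {n : ℕ} (hn : 1 ≤ n) {l : ℝ}
    (hl : 0 ≤ l) : (iterConv ν n).real (Set.Iic (Real.sqrt n * (-l))) ≤
      Real.exp (-(l ^ 2 / (4 * (48 * Real.exp (K ^ 2))))) := by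
  set A := 48 * Real.exp (K ^ 2) with hA
  have hA0 : 0 < A := by positivity
  have hn0 : (0 : ℝ) < n := by exact_mod_cast hn
  set r := Real.sqrt n with hr
  have hr0 : 0 < r := Real.sqrt_pos.2 hn0
  have hrr : r ^ 2 = n := Real.sq_sqrt hn0.le
  -- The minimizer of the Chernoff exponent `n * A * s ^ 2 - s * r * l`.
  set s := l / (2 * A * r) with hs
  have hs0 : 0 ≤ s := by positivity
  have hp : IsProbabilityMeasure (ν.tilted fun x => -s * x) :=
    isProbabilityMeasure_tilted (h.integrable_exp_neg_mul s)
  have h1 := mul_measureReal_iterConv_le ν (s := s) (D := Real.exp (s * (r * l)))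
    (h.integrable_exp_neg_mul s) n (A := Set.Iic (r * (-l))) measurableSet_Iic
    (Real.exp_pos _).le fun x hx => by
      have : x ≤ r * (-l) := hx
      exact Real.exp_le_exp.2 (by nlinarith)
  have h2 : (∫ y, Real.exp (-s * y) ∂ν) ^ n *
      (iterConv (ν.tilted fun x => -s * x) n).real (Set.Iic (r * (-l))) ≤
      Real.exp (n * (A * s ^ 2)) := by
    have h3 := h.integral_exp_neg_mul_le s
    have h4 : 0 ≤ ∫ y, Real.exp (-s * y) ∂ν := integral_nonneg fun y => (Real.exp_pos _).le
    calc _ ≤ (∫ y, Real.exp (-s * y) ∂ν) ^ n * 1 := by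
          gcongr
          exact measureReal_le_one
      _ ≤ Real.exp (A * s ^ 2) ^ n := by
          rw [mul_one]
          gcongr
      _ = _ := (Real.exp_nat_mul _ _).symm
  have h5 : (iterConv ν n).real (Set.Iic (r * (-l))) ≤
      Real.exp (-(s * (r * l))) * Real.exp (n * (A * s ^ 2)) := by
    rw [Real.exp_neg, ← div_eq_inv_mul, le_div_iff₀ (Real.exp_pos _), mul_comm]
    exact h1.trans h2
  refine h5.trans (le_of_eq ?_)
  rw [← Real.exp_add]
  congr 1
  rw [← hrr, hs]
  field_simp
  ring

end StdSubgaussian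

/-! ### Short intervals against the lower tail. -/

/-- In the moderate deviation range, the mass that a convolution power gives to short intervals in
the lower tail is controlled by the mass of the tail. -/
lemma exists_measureReal_iterConv_Ico_le (K : ℝ) : ∃ C η : ℝ, 0 < C ∧ 0 < η ∧
    ∀ (ν : Measure ℝ) [IsProbabilityMeasure ν], StdSubgaussian ν K →
    ∀ (n : ℕ) (l δ x : ℝ), 1 ≤ n → 2 ≤ l → l ^ 4 ≤ η * Real.sqrt n → 0 ≤ δ → δ * l ≤ 1 → x ≤ -l →
    (iterConv ν n).real (Set.Ico (Real.sqrt n * x) (Real.sqrt n * (x + δ))) ≤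
      C * (1 / Real.sqrt n + δ) * l * (iterConv ν n).real (Set.Iic (Real.sqrt n * (-l))) := by
  set A := 48 * Real.exp (K ^ 2) with hA
  have hA0 : 0 < A := by positivity
  have hA1 : 1 ≤ A := by
    have := Real.one_le_exp (sq_nonneg K)
    linarith
  obtain ⟨η₀, hη₀, hlow⟩ := exists_le_measureReal_iterConv_Icc (16 * A)
  -- The second bound in the minimum makes the tilt small enough for the moment estimates and keeps
  -- the tilted mean of the sum within `√n` of `-√n * l`. The factor `exp 6` collects `exp 4` from
  -- the Gaussian density and `exp 2` from the ratio of the two tilting weights.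
  refine ⟨24 * Real.exp 6 * (128 * (16 * A)), min η₀ (1 / (16 * A)), by positivity, by positivity,
    fun ν _ h n l δ x hn hl hln hδ hδl hx => ?_⟩
  have hn0 : (0 : ℝ) < n := by exact_mod_cast hn
  set r := Real.sqrt n with hr
  have hr0 : 0 < r := Real.sqrt_pos.2 hn0
  have hrr : r ^ 2 = n := Real.sq_sqrt hn0.le
  have hl0 : 0 < l := by linarith
  have hln1 : l ^ 4 ≤ η₀ * r := hln.trans (by gcongr; exact min_le_left _ _)
  have hln2 : 16 * A * l ^ 4 ≤ r := by
    have : l ^ 4 ≤ 1 / (16 * A) * r := hln.trans (by gcongr; exact min_le_right _ _)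
    rwa [one_div_mul_eq_div, le_div_iff₀ (by positivity), mul_comm] at this
  have hl2 : l ^ 2 ≤ l ^ 4 := pow_le_pow_right₀ (by linarith) (by norm_num)
  have hl1 : l ≤ l ^ 2 := by nlinarith
  set s := l / r with hs
  have hs0 : 0 < s := by positivity
  have hsr : s * r = l := by rw [hs]; field_simp
  have hsA : 16 * A * s ≤ 1 := by
    rw [hs, ← mul_div_assoc, div_le_one hr0]
    exact le_trans (by gcongr; exact hl1.trans hl2) hln2
  have hi := h.integrable_exp_neg_mul s
  have hp : IsProbabilityMeasure (ν.tilted fun x => -s * x) := isProbabilityMeasure_tilted hi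
  obtain ⟨m, v, hm, hms⟩ := h.exists_centralMoments_tilted hs0.le hsA
  rw [← hA] at hm hms
  have hmean : |n * m + r * l| ≤ r := by
    have e : n * m + r * l = n * (m + s) := by rw [← hrr, ← hsr]; ring
    rw [e, abs_mul, abs_of_pos hn0]
    calc n * |m + s| ≤ n * (4 * A * s ^ 2) := by gcongr
      _ = 4 * A * l ^ 2 := by rw [← hrr, ← hsr]; ring
      _ ≤ 16 * A * l ^ 4 := by nlinarith [sq_nonneg l]
      _ ≤ r := hln2
  have hlo := hlow (ν.tilted fun x => -s * x) m v hm n l hn hl hln1 hmean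
  have hup := hm.measureReal_iterConv_Ico_le (by linarith) hn (r * x) (l := r * δ) (by positivity)
  rw [← mul_add, ← hr] at hup
  have hZ : 0 < ∫ y, Real.exp (-s * y) ∂ν := integral_exp_pos hi
  set Z := ∫ y, Real.exp (-s * y) ∂ν with hZdef
  -- Below `r * (x + δ)` with `x ≤ -l`, the tilting exponent is at least `l ^ 2 - l * δ`, and `δ * l
  -- ≤ 1`.
  have h1 := mul_measureReal_iterConv_le ν (s := s) (D := Real.exp (l ^ 2 - 1)) hi n
    (A := Set.Ico (r * x) (r * (x + δ))) measurableSet_Ico (Real.exp_pos _).le fun y hy => by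
      refine Real.exp_le_exp.2 ?_
      have h3 := mul_le_mul_of_nonneg_left hy.2.le hs0.le
      rw [← mul_assoc, hsr] at h3
      nlinarith
  have h2 := mul_measureReal_iterConv_tilted_le ν (s := s) (D := Real.exp (l ^ 2 + 1)) hi n
    (A := Set.Icc (r * (-l - 1 / l)) (r * (-l))) measurableSet_Icc (Real.exp_pos _).le fun y hy => by
      refine Real.exp_le_exp.2 ?_
      have h3 := mul_le_mul_of_nonneg_left hy.1 hs0.le
      rw [← mul_assoc, hsr] at h3
      have h4 : l * (-l - 1 / l) = -l ^ 2 - 1 := by field_simp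
      linarith
  rw [← hZdef] at h1 h2
  have h3 : (iterConv ν n).real (Set.Icc (r * (-l - 1 / l)) (r * (-l))) ≤
      (iterConv ν n).real (Set.Iic (r * (-l))) := measureReal_mono Set.Icc_subset_Iic_self
  set p := (iterConv ν n).real (Set.Iic (r * (-l))) with hpdef
  set q := (iterConv ν n).real (Set.Ico (r * x) (r * (x + δ))) with hqdef
  have h4 : Z ^ n * (Real.exp (-4) / (24 * l)) ≤ Real.exp (l ^ 2 + 1) * p :=
    (mul_le_mul_of_nonneg_left hlo (by positivity)).trans
      (h2.trans (mul_le_mul_of_nonneg_left h3 (Real.exp_pos _).le))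
  have h5 : Z ^ n ≤ 24 * l * Real.exp (l ^ 2 + 5) * p := by
    have e : Real.exp (l ^ 2 + 5) = Real.exp (l ^ 2 + 1) * Real.exp 4 := by
      rw [← Real.exp_add]; ring_nf
    have e4 : Real.exp (-4) * Real.exp 4 = 1 := by rw [← Real.exp_add]; simp
    calc Z ^ n = (Z ^ n * (Real.exp (-4) / (24 * l))) * (24 * l * Real.exp 4) := by
          field_simp
          rw [e4]
      _ ≤ (Real.exp (l ^ 2 + 1) * p) * (24 * l * Real.exp 4) := by gcongr
      _ = _ := by rw [e]; ring
  have h6 : Real.exp (l ^ 2 - 1) * q ≤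
      (24 * l * Real.exp (l ^ 2 + 5) * p) * ((r * δ + 1) * (128 * (16 * A) / r)) := by
    refine h1.trans ?_
    have hq0 : 0 ≤ (iterConv (ν.tilted fun x => -s * x) n).real
      (Set.Ico (r * x) (r * (x + δ))) := measureReal_nonneg
    gcongr
  have e5 : Real.exp (l ^ 2 + 5) = Real.exp (l ^ 2 - 1) * Real.exp 6 := by
    rw [← Real.exp_add]; ring_nf
  rw [e5] at h6
  refine le_of_mul_le_mul_left (h6.trans (le_of_eq ?_)) (Real.exp_pos (l ^ 2 - 1))
  field_simp
  ring

/-! ### From random variables to their laws. -/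

lemma stdSubgaussian_map {Ω : Type*} [MeasurableSpace Ω] {μ : Measure Ω} [IsProbabilityMeasure μ]
    {W : Ω → ℝ} (hW : AEMeasurable W μ) (hψ : MemPsi 2 W μ) (h0 : ∫ ω, W ω ∂μ = 0)
    (h1 : variance W μ = 1) : StdSubgaussian (μ.map W) (psiNorm 2 W μ + 1) := by
  -- Adding `1` to the norm leaves room for an admissible constant strictly below, so the infimum
  -- need not be attained.
  obtain ⟨c, hc, hcL⟩ := exists_lt_of_csInf_lt hψ (lt_add_one (sInf (psiConstants 2 W μ)))
  obtain ⟨hc0, hc2⟩ := hc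
  set K := psiNorm 2 W μ + 1 with hK
  have hcK : c < K := hcL
  have hle : ∫⁻ ω, ENNReal.ofReal (Real.exp (W ω ^ 2 / K ^ 2)) ∂μ ≤ 2 := by
    refine le_trans (lintegral_mono fun ω => ENNReal.ofReal_le_ofReal ?_) hc2
    rw [Real.rpow_two, Real.rpow_two, sq_abs]
    gcongr
  have hm : AEMeasurable (fun ω => Real.exp (W ω ^ 2 / K ^ 2)) μ := by fun_prop
  have hi : Integrable (fun ω => Real.exp (W ω ^ 2 / K ^ 2)) μ := by
    refine ⟨hm.aestronglyMeasurable, ?_⟩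
    rw [hasFiniteIntegral_iff_ofReal (ae_of_all _ fun ω => (Real.exp_pos _).le)]
    exact hle.trans_lt (by simp)
  refine ⟨hc0.trans hcK, ?_, ?_, ?_, ?_⟩
  · exact (integrable_map_measure (by fun_prop) hW).2 hi
  · rw [integral_map hW (by fun_prop),
      integral_eq_lintegral_of_nonneg_ae (ae_of_all _ fun ω => (Real.exp_pos _).le)
        hm.aestronglyMeasurable]
    simpa using ENNReal.toReal_mono (by simp) hle
  · rw [integral_map hW (by fun_prop), h0]
  · rw [integral_map hW (by fun_prop), ← h1, variance_eq_integral hW, h0]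
    simp

lemma map_normalizedSum_eq {Ω : Type*} [MeasurableSpace Ω] {μ : Measure Ω}
    [IsProbabilityMeasure μ] {n : ℕ} {V : Fin n → Ω → ℝ} {ν : Measure ℝ} [IsProbabilityMeasure ν]
    (hV : iIndepFun V μ) (hm : ∀ i, AEMeasurable (V i) μ) (hν : ∀ i, μ.map (V i) = ν) :
    μ.map (normalizedSum V) = (iterConv ν n).map fun x => x / Real.sqrt n := by
  rw [← map_sum_eq_iterConv hV hm hν, AEMeasurable.map_map_of_aemeasurable (by fun_prop)
    (Finset.aemeasurable_fun_sum _ fun i _ => hm i)]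
  rfl

/-! ### The gap at the minimum of independent variables. -/

section MinimumGap

variable {Ω ι : Type*} [MeasurableSpace Ω] {P : Measure Ω} [IsProbabilityMeasure P] [Fintype ι]
  [Nonempty ι] {X : ι → Ω → ℝ} {ρ : Measure ℝ} [IsProbabilityMeasure ρ]

lemma measureReal_iInf_le (hX : iIndepFun X P) (hm : ∀ j, AEMeasurable (X j) P)
    (hρ : ∀ j, P.map (X j) = ρ) (γ : ℝ) :
    P.real {ω | (⨅ j, X j ω) ≤ γ} = 1 - (1 - ρ.real (Set.Iic γ)) ^ Fintype.card ι := by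
  have hc : {ω | (⨅ j, X j ω) ≤ γ}ᶜ = ⋂ j ∈ Finset.univ, X j ⁻¹' Set.Ioi γ := by
    ext ω
    simp only [Set.mem_compl_iff, Set.mem_ofPred_eq, not_le, Finset.mem_univ, Set.iInter_true,
      Set.mem_iInter, Set.mem_preimage, Set.mem_Ioi]
    obtain ⟨j₀, hj₀⟩ := exists_eq_ciInf_of_finite (f := fun j => X j ω)
    exact ⟨fun h j => h.trans_le (ciInf_le (Set.finite_range _).bddBelow j),
      fun h => hj₀ ▸ h j₀⟩
  have hnull : NullMeasurableSet (⋂ j ∈ Finset.univ, X j ⁻¹' Set.Ioi γ) P :=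
    Finset.nullMeasurableSet_biInter _ fun j _ => (hm j).nullMeasurableSet_preimage measurableSet_Ioi
  have hprod := hX.measure_inter_preimage_eq_mul Finset.univ (sets := fun _ => Set.Ioi γ)
    fun j _ => measurableSet_Ioi
  have hj : ∀ j, P (X j ⁻¹' Set.Ioi γ) = ρ (Set.Ioi γ) := fun j => by
    rw [← hρ j, Measure.map_apply_of_aemeasurable (hm j) measurableSet_Ioi]
  simp only [hj, Finset.prod_const, Finset.card_univ] at hprod
  have hIoi : ρ.real (Set.Ioi γ) = 1 - ρ.real (Set.Iic γ) := by
    rw [← Set.compl_Iic, probReal_compl_eq_one_sub measurableSet_Iic]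
  have h2 := probReal_compl_eq_one_sub₀ hnull
  rw [← hc, compl_compl] at h2
  rw [h2, hc, measureReal_def, hprod, ENNReal.toReal_pow, ← measureReal_def, hIoi]

omit [Fintype ι] [Nonempty ι] in
-- By independence and Fubini, `X j` can be frozen at a value `x ≤ γ`, and each section has mass at
-- most `Q`.
lemma measureReal_le_and_close_le (hX : iIndepFun X P) (hm : ∀ j, AEMeasurable (X j) P)
    (hρ : ∀ j, P.map (X j) = ρ) {γ δ Q : ℝ} (hQ : ∀ x ≤ γ, ρ.real (Set.Ico x (x + δ)) ≤ Q)
    {j k : ι} (hjk : j ≠ k) :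
    P.real {ω | X j ω ≤ γ ∧ X k ω ∈ Set.Ico (X j ω) (X j ω + δ)} ≤ ρ.real (Set.Iic γ) * Q := by
  have hQ0 : 0 ≤ Q := measureReal_nonneg.trans (hQ γ le_rfl)
  have hS : MeasurableSet {p : ℝ × ℝ | p.1 ≤ γ ∧ p.2 ∈ Set.Ico p.1 (p.1 + δ)} := by
    refine (measurableSet_le measurable_fst measurable_const).inter
      ((measurableSet_le measurable_fst measurable_snd).inter
      (measurableSet_lt measurable_snd (by fun_prop)))
  have hmap := (indepFun_iff_map_prod_eq_prod_map_map (hm j) (hm k)).1 (hX.indepFun hjk)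
  rw [hρ, hρ] at hmap
  have e : P {ω | X j ω ≤ γ ∧ X k ω ∈ Set.Ico (X j ω) (X j ω + δ)} =
      (ρ.prod ρ) {p : ℝ × ℝ | p.1 ≤ γ ∧ p.2 ∈ Set.Ico p.1 (p.1 + δ)} := by
    rw [← hmap, Measure.map_apply_of_aemeasurable ((hm j).prodMk (hm k)) hS]
    rfl
  have hle : P {ω | X j ω ≤ γ ∧ X k ω ∈ Set.Ico (X j ω) (X j ω + δ)} ≤
      ENNReal.ofReal Q * ρ (Set.Iic γ) := by
    rw [e, Measure.prod_apply hS, ← lintegral_indicator_const measurableSet_Iic]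
    refine lintegral_mono fun x => ?_
    by_cases hx : x ≤ γ
    · rw [Set.indicator_of_mem (show x ∈ Set.Iic γ from hx)]
      refine le_trans (measure_mono (t := Set.Ico x (x + δ)) fun y hy => hy.2) ?_
      rw [← ofReal_measureReal]
      exact ENNReal.ofReal_le_ofReal (hQ x hx)
    · rw [Set.indicator_of_notMem (show x ∉ Set.Iic γ from hx)]
      have : Prod.mk x ⁻¹' {p : ℝ × ℝ | p.1 ≤ γ ∧ p.2 ∈ Set.Ico p.1 (p.1 + δ)} = ∅ := by
        ext y
        simp [hx]
      rw [this, measure_empty]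
  have h := ENNReal.toReal_mono (ENNReal.mul_ne_top ENNReal.ofReal_ne_top (measure_ne_top _ _)) hle
  rw [ENNReal.toReal_mul, ENNReal.toReal_ofReal hQ0, mul_comm] at h
  exact h

/-- A minimiser below `γ` that is not isolated has some `X k` in the half-open interval of length
`δ` to its right; a union bound over ordered pairs follows. -/
lemma measureReal_iInf_le_sub_le (hX : iIndepFun X P) (hm : ∀ j, AEMeasurable (X j) P)
    (hρ : ∀ j, P.map (X j) = ρ) {γ δ Q : ℝ} (hQ : ∀ x ≤ γ, ρ.real (Set.Ico x (x + δ)) ≤ Q) :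
    P.real {ω | (⨅ j, X j ω) ≤ γ} - (Fintype.card ι : ℝ) ^ 2 * (ρ.real (Set.Iic γ) * Q) ≤
      P.real {ω | ∃ j, X j ω ≤ γ ∧ ∀ k, k ≠ j → δ ≤ X k ω - X j ω} := by
  classical
  have hQ0 : 0 ≤ Q := measureReal_nonneg.trans (hQ γ le_rfl)
  set G := {ω | ∃ j, X j ω ≤ γ ∧ ∀ k, k ≠ j → δ ≤ X k ω - X j ω} with hG
  set T : Finset (ι × ι) := Finset.univ.filter fun q => q.1 ≠ q.2 with hT
  have hsub : {ω | (⨅ j, X j ω) ≤ γ} ⊆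
      G ∪ ⋃ q ∈ T, {ω | X q.1 ω ≤ γ ∧ X q.2 ω ∈ Set.Ico (X q.1 ω) (X q.1 ω + δ)} := by
    intro ω hω
    obtain ⟨j, hj⟩ := exists_eq_ciInf_of_finite (f := fun j => X j ω)
    have hjγ : X j ω ≤ γ := by
      have : (⨅ j, X j ω) ≤ γ := hω
      rwa [← hj] at this
    by_cases hg : ∀ k, k ≠ j → δ ≤ X k ω - X j ω
    · exact Or.inl ⟨j, hjγ, hg⟩
    · push Not at hg
      obtain ⟨k, hkj, hk⟩ := hg
      right
      simp only [Set.mem_iUnion]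
      refine ⟨(j, k), by simp [hT, hkj.symm], hjγ, ?_, by linarith⟩
      have := ciInf_le (Set.finite_range fun j => X j ω).bddBelow k
      rwa [← hj] at this
  have hcard : (T.card : ℝ) ≤ (Fintype.card ι : ℝ) ^ 2 := by
    have : T.card ≤ Fintype.card (ι × ι) := Finset.card_le_univ _
    rw [Fintype.card_prod, ← pow_two] at this
    exact_mod_cast this
  have h1 : P.real {ω | (⨅ j, X j ω) ≤ γ} ≤ P.real G + T.card * (ρ.real (Set.Iic γ) * Q) := by
    calc P.real {ω | (⨅ j, X j ω) ≤ γ} ≤ _ := measureReal_mono hsub (measure_ne_top _ _)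
      _ ≤ P.real G + P.real (⋃ q ∈ T,
          {ω | X q.1 ω ≤ γ ∧ X q.2 ω ∈ Set.Ico (X q.1 ω) (X q.1 ω + δ)}) :=
          measureReal_union_le _ _
      _ ≤ P.real G + ∑ q ∈ T,
          P.real {ω | X q.1 ω ≤ γ ∧ X q.2 ω ∈ Set.Ico (X q.1 ω) (X q.1 ω + δ)} := by
          gcongr
          exact measureReal_biUnion_finset_le _ _
      _ ≤ P.real G + ∑ q ∈ T, ρ.real (Set.Iic γ) * Q := by
          gcongr with q hq
          exact measureReal_le_and_close_le hX hm hρ hQ (by simpa [hT] using hq)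
      _ = _ := by simp
  have h2 : (T.card : ℝ) * (ρ.real (Set.Iic γ) * Q) ≤
      (Fintype.card ι : ℝ) ^ 2 * (ρ.real (Set.Iic γ) * Q) := by gcongr
  linarith

end MinimumGap

/-! ### Elementary estimates for `n`, `M` and `γ₁`. -/

lemma exists_nat_log_sq_le (a : ℝ) {η : ℝ} (hη : 0 < η) : ∃ N₀ : ℕ, ∀ n : ℕ, N₀ ≤ n →
    1 ≤ Real.log n ∧ a * Real.log n ^ 2 ≤ η * Real.sqrt n := by
  have h1 : ∀ᶠ x : ℝ in Filter.atTop, 1 ≤ Real.log x :=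
    Real.tendsto_log_atTop.eventually_ge_atTop 1
  have h2 := (isLittleO_log_rpow_rpow_atTop 2 (by norm_num : (0 : ℝ) < 1 / 2)).bound
    (c := η / (|a| + 1)) (by positivity)
  obtain ⟨N₀, hN₀⟩ := Filter.eventually_atTop.1
    ((h1.and h2).filter_mono tendsto_natCast_atTop_atTop)
  refine ⟨N₀, fun n hn => ⟨(hN₀ n hn).1, ?_⟩⟩
  obtain ⟨h3, h4⟩ := hN₀ n hn
  have hs : ((n : ℝ) ^ (1 / 2 : ℝ)) = Real.sqrt n := (Real.sqrt_eq_rpow _).symm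
  rw [hs, Real.rpow_two, Real.norm_of_nonneg (by positivity), Real.norm_of_nonneg (by positivity),
    div_mul_eq_mul_div, le_div_iff₀ (by positivity)] at h4
  have h5 := le_abs_self a
  nlinarith [sq_nonneg (Real.log n)]

/-- This is how the choice of `c₁` disposes of small `n`: if `n < N₀` the exponential is at least
`exp (-1) ≥ 1 / 3`, while `2 * M ^ 2 ≥ 8`. -/
lemma le_of_two_mul_sq_mul_exp_lt_one {N₀ n : ℕ} {M : ℝ} (hn : 1 ≤ n) (hM : 2 ≤ M)
    (h : 2 * M ^ 2 * Real.exp (-(1 / ((N₀ : ℝ) + 1)) * (n : ℝ) ^ (1 / 3 : ℝ)) < 1) : N₀ ≤ n := by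
  by_contra hlt
  have hn1 : (1 : ℝ) ≤ n := by exact_mod_cast hn
  have hlt' : (n : ℝ) ≤ N₀ := by exact_mod_cast (not_le.1 hlt).le
  have h1 : (n : ℝ) ^ (1 / 3 : ℝ) ≤ n := by
    simpa using Real.rpow_le_rpow_of_exponent_le hn1 (by norm_num : (1 / 3 : ℝ) ≤ 1)
  have h2 : 1 / ((N₀ : ℝ) + 1) * (n : ℝ) ^ (1 / 3 : ℝ) ≤ 1 := by
    rw [one_div_mul_eq_div, div_le_one (by positivity)]
    linarith
  have h3 : Real.exp (-1) ≤ Real.exp (-(1 / ((N₀ : ℝ) + 1)) * (n : ℝ) ^ (1 / 3 : ℝ)) := by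
    gcongr
    linarith
  have h4 : (1 : ℝ) / 3 ≤ Real.exp (-1) := by
    rw [Real.exp_neg, one_div]
    gcongr
    linarith [Real.exp_one_lt_d9]
  have h5 : (4 : ℝ) ≤ M ^ 2 := by nlinarith
  nlinarith

lemma log_le_two_mul_log {n M : ℝ} (hM : 0 < M) (hn2 : 2 ≤ n)
    (h : M ≤ Real.sqrt n * Real.log n) : Real.log M ≤ 2 * Real.log n := by
  have hr0 : 0 < Real.sqrt n := Real.sqrt_pos.2 (by linarith)
  have h1 : Real.log n ≤ 2 * Real.sqrt n := by
    have h2 := Real.log_le_sub_one_of_pos hr0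
    rw [Real.log_sqrt (by linarith)] at h2
    linarith
  have h2 : M ≤ n ^ 2 := by
    have h3 : Real.sqrt n * Real.sqrt n = n := Real.mul_self_sqrt (by linarith)
    calc M ≤ Real.sqrt n * (2 * Real.sqrt n) := h.trans (by gcongr)
      _ = 2 * n := by linear_combination 2 * h3
      _ ≤ n ^ 2 := by nlinarith
  have h3 := Real.log_le_log hM h2
  rw [Real.log_pow] at h3
  exact_mod_cast h3

lemma mul_le_log_of_one_sub_pow_eq {n p : ℝ} {N : ℕ} (hn : 0 < n) (hp1 : p ≤ 1)
    (h : (1 - p) ^ N = 1 / n) : N * p ≤ Real.log n := by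
  have h1 : (1 - p) ^ N ≤ Real.exp (-p) ^ N :=
    pow_le_pow_left₀ (by linarith) (Real.one_sub_le_exp_neg p) N
  rw [h, ← Real.exp_nat_mul, one_div, ← Real.exp_log hn, ← Real.exp_neg, Real.exp_le_exp] at h1
  linarith

/-- A tail probability of at least `1 / (2 * M)` cannot lie too far out, by Chernoff's bound. -/
lemma sq_le_mul_log_of_le_exp {A M p l : ℝ} (hA : 0 < A) (hM : 2 ≤ M) (hp : 1 ≤ 2 * M * p)
    (h : p ≤ Real.exp (-(l ^ 2 / (4 * A)))) : l ^ 2 ≤ 8 * A * Real.log M := by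
  have h2 : Real.exp (l ^ 2 / (4 * A)) ≤ 2 * M := by
    rw [Real.exp_neg] at h
    have h3 : 2 * M * p ≤ 2 * M * (Real.exp (l ^ 2 / (4 * A)))⁻¹ := by gcongr
    have h4 := hp.trans h3
    rwa [← div_eq_mul_inv, le_div_iff₀ (Real.exp_pos _), one_mul] at h4
  rw [← Real.le_log_iff_exp_le (by positivity), div_le_iff₀ (by positivity),
    Real.log_mul (by norm_num) (by positivity)] at h2
  have h3 : Real.log 2 ≤ Real.log M := Real.log_le_log (by norm_num) hM
  have h4 : (Real.log 2 + Real.log M) * (4 * A) ≤ (Real.log M + Real.log M) * (4 * A) := by gcongr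
  linarith

/-! ### Choice of constants and conclusion. -/

theorem mainTheorem4 (L : ℝ) :
    ∃ c₁ c₂ c₃ c₄ : ℝ, 0 < c₁ ∧ 0 < c₂ ∧ 0 < c₃ ∧ 0 < c₄ ∧
      ∀ (Ω₀ : Type*) [MeasurableSpace Ω₀] (μ : Measure Ω₀) [IsProbabilityMeasure μ]
        (Ω : Type*) [MeasurableSpace Ω] (P : Measure Ω) [IsProbabilityMeasure P]
        (W : Ω₀ → ℝ) (n M : ℕ) (V : Fin n → Ω₀ → ℝ) (X : Set.Icc 2 M → Ω → ℝ) (γ₁ δ : ℝ),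
        -- the variable `W`
        AEMeasurable W μ →
        μ.map W ≪ volume →
        MemPsi 2 W μ →
        psiNorm 2 W μ = L →
        ∫ ω, W ω ∂μ = 0 →
        variance W μ = 1 →
        ∫ ω, W ω ^ 3 ∂μ = 0 →
        -- `V 0, …, V (n - 1)` are independent and distributed as `W`
        iIndepFun V μ →
        (∀ i, IdentDistrib (V i) W μ μ) →
        -- `X 2, …, X M` are independent copies of the normalized sum of the `V i`
        iIndepFun X P →
        (∀ j, IdentDistrib (X j) (normalizedSum V) P μ) →
        1 ≤ n →
        2 ≤ M →
        c₃ * Real.log n ≤ M →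
        (M : ℝ) ≤ c₄ * Real.sqrt n * Real.log n →
        P.real {ω | (⨅ j, X j ω) ≤ γ₁} = 1 - 1 / (n : ℝ) →
        γ₁ ≤ -2 →
        2 * (M : ℝ) ^ 2 * Real.exp (-c₁ * (n : ℝ) ^ (1 / 3 : ℝ)) < δ →
        δ ≤ 1 →
        1 - 1 / (n : ℝ)
            - c₂ * (1 / Real.sqrt n + δ) * Real.log n ^ 2 * Real.sqrt (Real.log M)
          ≤ P.real {ω | ∃ j, X j ω ≤ γ₁ ∧ ∀ k, k ≠ j → δ ≤ X k ω - X j ω} := by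
  set A := 48 * Real.exp ((L + 1) ^ 2) with hA
  have hA0 : 0 < A := by positivity
  obtain ⟨C, η, hC, hη, hkey⟩ := exists_measureReal_iterConv_Ico_le (L + 1)
  -- The constant comes from squaring `l ^ 2 ≤ 16 * A * log n`.
  obtain ⟨N₀, hN₀⟩ := exists_nat_log_sq_le (256 * A ^ 2) hη
  -- `C + 1` rather than `C` makes the error term also cover the trivial case `δ * l > 1` at the
  -- end.
  refine ⟨1 / ((N₀ : ℝ) + 1), (C + 1) * Real.sqrt (8 * A), 1, 1, by positivity, by positivity,
    one_pos, one_pos, ?_⟩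
  intro Ω₀ _ μ _ Ω _ P _ W n M V X γ δ hW _ hψ hL hW0 hW1 _ hV hVW hX hXV hn hM _ hMn hmin hγ
    hδ hδ1
  have hn1 : (1 : ℝ) ≤ n := by exact_mod_cast hn
  have hM2 : (2 : ℝ) ≤ M := by exact_mod_cast hM
  have hδ0 : 0 < δ := lt_of_le_of_lt (by positivity) hδ
  have hNn : N₀ ≤ n := le_of_two_mul_sq_mul_exp_lt_one hn hM2 (hδ.trans_le hδ1)
  obtain ⟨hlog1, hlog2⟩ := hN₀ n hNn
  have hn0 : (0 : ℝ) < n := by linarith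
  have hr0 : 0 < Real.sqrt n := Real.sqrt_pos.2 hn0
  have hn2 : (2 : ℝ) ≤ n := by
    have := Real.log_le_sub_one_of_pos hn0
    linarith
  -- the laws of the variables
  set ν := μ.map W with hν
  have hνp : IsProbabilityMeasure ν := Measure.isProbabilityMeasure_map hW
  have hstd : StdSubgaussian ν (L + 1) := hL ▸ stdSubgaussian_map hW hψ hW0 hW1
  set ρ := (iterConv ν n).map fun x => x / Real.sqrt n with hρ
  have hρp : IsProbabilityMeasure ρ := Measure.isProbabilityMeasure_map (by fun_prop)
  have hXm : ∀ j, AEMeasurable (X j) P := fun j => (hXV j).aemeasurable_fst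
  have hXρ : ∀ j, P.map (X j) = ρ := fun j => (hXV j).map_eq.trans
    (map_normalizedSum_eq hV (fun i => (hVW i).aemeasurable_fst) fun i => (hVW i).map_eq)
  have hIic : ρ.real (Set.Iic γ) = (iterConv ν n).real (Set.Iic (Real.sqrt n * γ)) := by
    rw [hρ, map_measureReal_apply (by fun_prop) measurableSet_Iic]
    congr 1
    ext x
    simp only [Set.mem_preimage, Set.mem_Iic]
    rw [div_le_iff₀ hr0, mul_comm]
  have hIco : ∀ x, ρ.real (Set.Ico x (x + δ)) =
      (iterConv ν n).real (Set.Ico (Real.sqrt n * x) (Real.sqrt n * (x + δ))) := fun x => by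
    rw [hρ, map_measureReal_apply (by fun_prop) measurableSet_Ico]
    congr 1
    ext y
    simp only [Set.mem_preimage, Set.mem_Ico]
    rw [le_div_iff₀ hr0, div_lt_iff₀ hr0, mul_comm x, mul_comm (x + δ)]
  set p := ρ.real (Set.Iic γ) with hp
  have hp0 : 0 ≤ p := measureReal_nonneg
  have hp1 : p ≤ 1 := measureReal_le_one
  have hne : Nonempty (Set.Icc 2 M) := ⟨⟨2, le_rfl, hM⟩⟩
  have hcard : Fintype.card (Set.Icc 2 M) = M - 1 := by simp
  set N := M - 1 with hN
  have hN1 : 1 ≤ N := by omega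
  have hN1' : (1 : ℝ) ≤ N := by exact_mod_cast hN1
  have hNM : (N : ℝ) ≤ M := by exact_mod_cast Nat.sub_le M 1
  have hpow : (1 - p) ^ N = 1 / n := by
    have := measureReal_iInf_le hX hXm hXρ γ
    rw [hmin, hcard] at this
    linarith
  have hNp : N * p ≤ Real.log n := mul_le_log_of_one_sub_pow_eq hn0 hp1 hpow
  -- Bernoulli's inequality gives `1 - N * p ≤ 1 / n ≤ 1 / 2`.
  have hpM : 1 ≤ 2 * M * p := by
    have h1 := one_add_mul_le_pow (a := -p) (by linarith) N
    rw [← sub_eq_add_neg, hpow] at h1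
    have h2 : (1 : ℝ) / n ≤ 1 / 2 := by gcongr
    have h3 : N * p ≤ M * p := by gcongr
    linarith
  -- the size of `γ`
  set l := -γ with hl
  have hl2 : 2 ≤ l := by linarith
  have hγl : γ = -l := by linarith
  have hlM : l ^ 2 ≤ 8 * A * Real.log M := by
    have h1 := hstd.measureReal_iterConv_Iic_le hn (l := l) (by linarith)
    rw [← hγl, ← hIic, ← hA] at h1
    exact sq_le_mul_log_of_le_exp hA0 hM2 hpM h1
  have hlogM : Real.log M ≤ 2 * Real.log n :=
    log_le_two_mul_log (by linarith) hn2 (by rwa [one_mul] at hMn)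
  have hl4 : l ^ 4 ≤ η * Real.sqrt n := by
    have h1 : l ^ 2 ≤ 16 * A * Real.log n := by
      have := mul_le_mul_of_nonneg_left hlogM (show 0 ≤ 8 * A by positivity)
      linarith
    calc l ^ 4 = (l ^ 2) ^ 2 := by ring
      _ ≤ (16 * A * Real.log n) ^ 2 := by gcongr
      _ = 256 * A ^ 2 * Real.log n ^ 2 := by ring
      _ ≤ _ := hlog2
  set S := Real.sqrt (8 * A) * Real.sqrt (Real.log M) with hS
  have hS0 : 0 ≤ S := by positivity
  have hlS : l ≤ S := by
    rw [hS, ← Real.sqrt_mul (by positivity)]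
    exact Real.le_sqrt_of_sq_le hlM
  have hrhs : (C + 1) * Real.sqrt (8 * A) * (1 / Real.sqrt n + δ) * Real.log n ^ 2 *
      Real.sqrt (Real.log M) = (C + 1) * (1 / Real.sqrt n + δ) * Real.log n ^ 2 * S := by
    rw [hS]; ring
  rw [hrhs]
  have hinv : 0 < 1 / Real.sqrt n := by positivity
  have hlogsq : 1 ≤ Real.log n ^ 2 := one_le_pow₀ hlog1
  by_cases hδl : δ * l ≤ 1
  · have hQ : ∀ x ≤ γ, ρ.real (Set.Ico x (x + δ)) ≤ C * (1 / Real.sqrt n + δ) * l * p := by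
      intro x hx
      rw [hIco, hIic, hγl]
      exact hkey ν hstd n l δ x hn hl2 hl4 hδ0.le hδl (by linarith)
    have h1 := measureReal_iInf_le_sub_le hX hXm hXρ hQ
    rw [hmin, hcard, ← hp] at h1
    have h2 : (N : ℝ) ^ 2 * (p * (C * (1 / Real.sqrt n + δ) * l * p)) ≤
        (C + 1) * (1 / Real.sqrt n + δ) * Real.log n ^ 2 * S := by
      calc (N : ℝ) ^ 2 * (p * (C * (1 / Real.sqrt n + δ) * l * p))
          = C * (1 / Real.sqrt n + δ) * (N * p) ^ 2 * l := by ring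
        _ ≤ (C + 1) * (1 / Real.sqrt n + δ) * Real.log n ^ 2 * S := by
          gcongr
          linarith
    linarith
  -- Here `δ * l > 1` and `l ≤ S`, so the error term exceeds `1` and the lower bound is negative.
  · have h1 : 1 ≤ (C + 1) * (1 / Real.sqrt n + δ) * Real.log n ^ 2 * S := by
      calc (1 : ℝ) ≤ 1 * (0 + δ) * 1 * l := by linarith
        _ ≤ _ := by
          gcongr
          linarith
    have h2 : 0 < 1 / (n : ℝ) := by positivity
    have h3 : 0 ≤ P.real {ω | ∃ j, X j ω ≤ γ ∧ ∀ k, k ≠ j → δ ≤ X k ω - X j ω} :=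
      measureReal_nonneg
    linarith
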